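/- Let $\mathcal L$ be a relational language consisting of a distinguished binary symbol $d$ and further predicate symbols, each with a natural number as arity, such that there are only finitely many symbols of each arity $m\ge 1$. An *$\mathcal L$-structure* is a (possibly empty) complete metric space $(A,d)$ with a continuous interpretation $R^A\colon A^n\to\mathbb R$ of each $n$-ary symbol $R$ other than $d$ (and $d$ interpreted by the metric). An *embedding* is a map preserving the values of all predicate symbols, $d$ included; an *isomorphism* is a surjective embedding. The finite substructures of $\mathfrak A$ are the finite structures that embed in $\mathfrak A$. A structure $\mathfrak M$ is *ultrahomogeneous* if every embedding $\phi\colon M_0\to M$ of a finite subset $M_0\subseteq M$ extends to an automorphism of $\mathfrak M$. Let $\mathcal K$ be a nonempty class of finite $\mathcal L$-structures. A *$\mathcal K$-structure* is an $\mathcal L$-structure all of whose finite substructures are in $\mathcal K$. Let $\mathcal K_n$ be the set of enumerated structures of length $n$, i.e. $n$-tuples $\bar a$ of elements of structures in $\mathcal K$; an embedding of $\bar a$ into a structure $\mathfrak C$ is a map from its entries to $C$ preserving the values of all predicate symbols. For $\bar a,\bar b\in\mathcal K_n$ let $d_{\mathcal K}(\bar a,\bar b)=\inf\max_i d(a_i',b_i')$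 over all images $\bar a',\bar b'$ of $\bar a,\bar b$ under embeddings into a common structure in $\mathcal K$, and let $$d_\infty(\bar a,\bar b)=\max_{1\le m\le n}\ \max_{X\subseteq\{1,\dots,n\},\,|X|=m,\ R\ m\text{-ary}}|R(\bar a_X)-R(\bar b_X)|,$$ where $\bar a_X$ is the subtuple with indices in $X$ in increasing order and $R$ ranges over all predicate symbols including $d$. Consider the following properties of $\mathcal K$. * **HP**: all members of $\mathcal K$ are $\mathcal K$-structures. * **JEP**: any two members of $\mathcal K$ embed into a third one. * **AP**: for all $\mathfrak A,\mathfrak B,\mathfrak C\in\mathcal K$ and embeddings $f_B\colon\mathfrak A\to\mathfrak B$, $f_C\colon\mathfrak A\to\mathfrak C$ there are $\mathfrak D\in\mathcal K$ and embeddings $g_B\colon\mathfrak B\to\mathfrak D$, $g_C\colon\mathfrak C\to\mathfrak D$ with $g_Bf_B=g_Cf_C$. * **bAP**: for every $n\ge1$ there is a constant $c$ such that whenever $(\bar a,w),(\bar a,z)\in\mathcal K_{n+1}$ have the common substructure $\bar a$ of length $n$, there is an amalgamation $B=(\bar a,w,z)\in\mathcal K_{n+2}$ (containing the given copies of $(\bar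 a,w)$ and $(\bar a,z)$) with $d_B(w,z)\le c\,d_\infty((\bar a,w),(\bar a,z))$. * **PP**: $(\mathcal K_n,d_{\mathcal K})$ is separable and complete for every $n$. * **CP**: for every $n$-ary predicate symbol $P$, the map $\mathcal K_n\to\mathbb R$, $\bar a\mapsto P(\bar a)$, is continuous for $d_{\mathcal K}$. $\mathcal K$ is a *Fraïssé class* if it satisfies HP, JEP, AP, PP and CP. A separable $\mathcal K$-structure $\mathfrak M$ is an *approximate limit* of $\mathcal K$ if for every finite $\mathcal K$-structure $\mathfrak B$, every finite tuple $\bar a$ in $B$, every embedding $h\colon\bar a\to\mathfrak M$ and every $\varepsilon>0$ there is an embedding $f\colon\mathfrak B\to\mathfrak M$ with $\max_i d(f(a_i),h(a_i))<\varepsilon$; it is an *exact limit* if $f$ can always be chosen to extend $h$. **Theorem.** Suppose that $\mathcal K$ satisfies HP, JEP, bAP, PP and CP. Then $\mathcal K$ is a Fraïssé class and has an approximate limit. Every approximate limit $\mathfrak M$ of $\mathcal K$ 1. is an exact limit and is ultrahomogeneous; 2. is universal: every separable $\mathcal K$-structure embeds in $\mathfrak M$; 3. is isomorphic to every other approximate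 limit of $\mathcal K$, and to every separable $\mathcal K$-structure that is ultrahomogeneous and universal for separable $\mathcal K$-structures. Moreover, all predicates of $\mathfrak M$ are uniformly continuous if and only if the maps $\mathcal K_n\to\mathbb R$ in CP are all uniformly continuous for $d_{\mathcal K}$. -/

import Mathlib

open scoped ENNReal NNReal

universe u v

/-- The predicate symbols of the language whose non-metric `n`-ary symbols form `L n`:
those symbols, and the distinguished binary symbol `d` for the metric. -/
inductive PredSymbol (L : ℕ → Type v) : ℕ → Type v
  | metric : PredSymbol L 2
  | other {n : ℕ} (R : L n) : PredSymbol L n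

/-- A relational metric structure: a complete metric space with a continuous interpretation
`Aⁿ → ℝ` of every `n`-ary predicate symbol. The domain may be empty. -/
structure MetricStructure (L : ℕ → Type v) where
  carrier : Type u
  [metricSpace : MetricSpace carrier]
  [complete : CompleteSpace carrier]
  rel : ∀ {n : ℕ}, L n → (Fin n → carrier) → ℝ
  continuous_rel : ∀ {n : ℕ} (R : L n), Continuous (rel R)

namespace MetricStructure

variable {L : ℕ → Type v}

instance : CoeSort (MetricStructure.{u} L) (Type u) := ⟨carrier⟩

instance (A : MetricStructure.{u} L) : MetricSpace A := A.metricSpace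

instance (A : MetricStructure.{u} L) : CompleteSpace A := A.complete

/-- The value of a predicate symbol on a tuple; the symbol `d` is read as the metric. -/
def interp (A : MetricStructure.{u} L) : {n : ℕ} → PredSymbol L n → (Fin n → A) → ℝ
  | _, .metric, a => dist (a 0) (a 1)
  | _, .other R, a => A.rel R a

/-- All interpretations of predicate symbols are uniformly continuous. -/
def UniformlyContinuous (A : MetricStructure.{u} L) : Prop :=
  ∀ (n : ℕ) (R : L n), UniformContinuous (A.rel R)

/-- Embeddings preserve the values of all predicate symbols, including the metric. -/
structure Embedding (A B : MetricStructure.{u} L) where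
  toFun : A → B
  map_interp : ∀ {n : ℕ} (P : PredSymbol L n) (a : Fin n → A),
    B.interp P (fun i => toFun (a i)) = A.interp P a

instance (A B : MetricStructure.{u} L) : CoeFun (Embedding A B) (fun _ => A → B) :=
  ⟨Embedding.toFun⟩

/-- An isomorphism is a surjective embedding. -/
def Isomorphic (A B : MetricStructure.{u} L) : Prop :=
  ∃ f : Embedding A B, Function.Surjective f

/-- The map `a i ↦ b i` is an embedding of the enumerated structure `a` onto `b`: all predicate
symbols take the same values on corresponding tuples of entries. -/
def TupleEmbeds {A B : MetricStructure.{u} L} {n : ℕ} (a : Fin n → A) (b : Fin n → B) : Prop :=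
  ∀ (m : ℕ) (P : PredSymbol L m) (s : Fin m → Fin n),
    B.interp P (fun i => b (s i)) = A.interp P (fun i => a (s i))

/-- Every finite partial isomorphism of `M` extends to an automorphism. -/
def Ultrahomogeneous (M : MetricStructure.{u} L) : Prop :=
  ∀ (S : Set M), S.Finite → ∀ φ : S → M,
    (∀ (n : ℕ) (P : PredSymbol L n) (a : Fin n → S),
      M.interp P (fun i => φ (a i)) = M.interp P (fun i => (a i : M))) →
    ∃ f : Embedding M M, Function.Surjective f ∧ ∀ x : S, f x = φ x

end MetricStructure

open MetricStructure in
/-- `A` is a `K`-structure: all its finite substructures (the finite structures that embed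
in it) belong to `K`. -/
def IsKStructure {L : ℕ → Type v} (K : MetricStructure.{u} L → Prop)
    (A : MetricStructure.{u} L) : Prop :=
  ∀ B : MetricStructure.{u} L, Finite B → Nonempty (Embedding B A) → K B

namespace FraisseClass

open MetricStructure

variable {L : ℕ → Type v} (K : MetricStructure.{u} L → Prop)

/-- Hereditary property. -/
def HP : Prop := ∀ A : MetricStructure.{u} L, K A → IsKStructure K A

/-- Joint embedding property. -/
def JEP : Prop :=
  ∀ A B : MetricStructure.{u} L, K A → K B →
    ∃ C : MetricStructure.{u} L, K C ∧ Nonempty (Embedding A C) ∧ Nonempty (Embedding B C)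

/-- Amalgamation property. -/
def AP : Prop :=
  ∀ A B C : MetricStructure.{u} L, K A → K B → K C →
    ∀ (fB : Embedding A B) (fC : Embedding A C),
      ∃ D : MetricStructure.{u} L, K D ∧
        ∃ (gB : Embedding B D) (gC : Embedding C D), ∀ a : A, gB (fB a) = gC (fC a)

/-- Enumerated structures of length `n`: tuples of `n` elements of a structure in `K`. -/
structure Enumerated (n : ℕ) where
  ambient : MetricStructure.{u} L
  mem : K ambient
  tuple : Fin n → ambient

variable {K} in
/-- The value of an `n`-ary predicate symbol on an enumerated structure of length `n`. -/
def Enumerated.value {n : ℕ} (a : Enumerated K n) (P : PredSymbol L n) : ℝ :=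
  a.ambient.interp P a.tuple

variable {K} in
/-- The pseudometric `d_K`: the infimum of `max_i d(a'_i, b'_i)` over all images `a'`, `b'` of the
enumerated structures `a`, `b` in a common structure in `K` (it is `∞` if there are none). -/
noncomputable def distK {n : ℕ} (a b : Enumerated K n) : ℝ≥0∞ :=
  ⨅ (C : MetricStructure.{u} L) (_ : K C) (a' : Fin n → C) (b' : Fin n → C)
    (_ : TupleEmbeds a.tuple a') (_ : TupleEmbeds b.tuple b'), ⨆ i, edist (a' i) (b' i)

variable {K} in
/-- The distance `d_∞`: the maximal difference of the values of an `m`-ary predicate symbol on the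
subtuples of `a` and `b` given by an `m`-element set of indices, `1 ≤ m ≤ n`. Such a set is
the image of a unique increasing map `Fin m ↪o Fin n`. -/
noncomputable def distInfty {n : ℕ} (a b : Enumerated K n) : ℝ≥0∞ :=
  ⨆ (m : ℕ) (_ : 1 ≤ m) (_ : m ≤ n) (P : PredSymbol L m) (s : Fin m ↪o Fin n),
    ENNReal.ofReal |a.ambient.interp P (fun i => a.tuple (s i)) -
      b.ambient.interp P (fun i => b.tuple (s i))|

/-- Bounded amalgamation property. Here `n ≥ 1` is the length of the common part: `x = (ā, w)` and
`y = (ā, z)` have length `n + 1`, and the amalgamation `(ā, w, z)` consists of the entries of `a'`,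
`w'` and `z'` in `C`. (Nothing is demanded for an empty common part.) -/
def BAP : Prop :=
  ∀ n : ℕ, 1 ≤ n → ∃ c : ℝ≥0, ∀ x y : Enumerated K (n + 1),
    TupleEmbeds (fun i : Fin n => x.tuple i.castSucc) (fun i : Fin n => y.tuple i.castSucc) →
    ∃ C : MetricStructure.{u} L, K C ∧ ∃ (a' : Fin n → C) (w' z' : C),
      TupleEmbeds x.tuple (Fin.snoc a' w' : Fin (n + 1) → C) ∧
      TupleEmbeds y.tuple (Fin.snoc a' z' : Fin (n + 1) → C) ∧
      edist w' z' ≤ c * distInfty x y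

/-- Polish property: each space of enumerated structures is separable and complete
under `d_K`. -/
def PP : Prop :=
  ∀ n : ℕ,
    (∃ S : Set (Enumerated K n), S.Countable ∧
      ∀ (a : Enumerated K n) (ε : ℝ≥0∞), 0 < ε → ∃ s ∈ S, distK a s < ε) ∧
    ∀ x : ℕ → Enumerated K n,
      (∀ ε : ℝ≥0∞, 0 < ε → ∃ N, ∀ i ≥ N, ∀ j ≥ N, distK (x i) (x j) < ε) →
      ∃ a : Enumerated K n, ∀ ε : ℝ≥0∞, 0 < ε → ∃ N, ∀ i ≥ N, distK (x i) a < ε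

/-- Continuity property: predicate symbols are continuous for `d_K`. -/
def CP : Prop :=
  ∀ (n : ℕ) (P : PredSymbol L n) (a : Enumerated K n) (ε : ℝ), 0 < ε →
    ∃ δ : ℝ≥0∞, 0 < δ ∧ ∀ b : Enumerated K n, distK a b < δ → |a.value P - b.value P| < ε

/-- Predicate symbols are uniformly continuous for `d_K`. -/
def UniformCP : Prop :=
  ∀ (n : ℕ) (P : PredSymbol L n) (ε : ℝ), 0 < ε →
    ∃ δ : ℝ≥0∞, 0 < δ ∧
      ∀ a b : Enumerated K n, distK a b < δ → |a.value P - b.value P| < ε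

/-- Fraïssé classes. -/
structure IsFraisse : Prop where
  finite : ∀ A : MetricStructure.{u} L, K A → Finite A
  hp : HP K
  jep : JEP K
  ap : AP K
  pp : PP K
  cp : CP K

/-- Separable `K`-structures. -/
def IsSeparableKStructure (M : MetricStructure.{u} L) : Prop :=
  TopologicalSpace.SeparableSpace M ∧ IsKStructure K M

/-- An approximate limit: a separable `K`-structure with the approximate extension property. -/
def IsApproximateLimit (M : MetricStructure.{u} L) : Prop :=
  IsSeparableKStructure K M ∧
    ∀ B : MetricStructure.{u} L, Finite B → IsKStructure K B →
      ∀ (n : ℕ) (a : Fin n → B) (h : Fin n → M), TupleEmbeds a h →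
        ∀ ε : ℝ, 0 < ε → ∃ f : Embedding B M, ∀ i, dist (f (a i)) (h i) < ε

/-- An exact limit: a separable `K`-structure with the exact extension property. -/
def IsExactLimit (M : MetricStructure.{u} L) : Prop :=
  IsSeparableKStructure K M ∧
    ∀ B : MetricStructure.{u} L, Finite B → IsKStructure K B →
      ∀ (n : ℕ) (a : Fin n → B) (h : Fin n → M), TupleEmbeds a h →
        ∃ f : Embedding B M, ∀ i, f (a i) = h i

/-- Every separable `K`-structure embeds in `M`. -/
def IsUniversal (M : MetricStructure.{u} L) : Prop :=
  ∀ N : MetricStructure.{u} L, IsSeparableKStructure K N → Nonempty (Embedding N M)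

end FraisseClass

/-! Adjoining points one at a time with bAP gives amalgamation over nonempty bases, and JEP covers
the empty base; so `K` is a Fraïssé class. Amalgamation makes `d_K` satisfy the triangle inequality
(`Near.trans`).

An approximate limit is the completion of a generic sequence. Conditions are finite pieces of such a
sequence, and an ideal of them meets countably many requirements: each `s` in a countable
`d_K`-dense set must have a copy near each given tuple, to within `2⁻ᵏ`, whenever this is
consistent. Predicates need not be uniformly continuous, but they still extend to the completion: by
PP the types of approximating tuples converge in `K_n`, and by CP their values converge
(`exists_limit_type`). An arbitrary finite `B` is then reached as a limit of copies of dense `s`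
(`isApproximateLimit_of_dense`).

The constant in bAP turns approximate into exact (`exists_step`). Suppose `(a, z)` has the desired
type and `a` is close to `h`. Then the types of `(a, z)` and `(h, z)` are `d_∞`-close, by CP and the
finiteness of the sets of symbols. So bAP amalgamates over `h` a point `w` of the desired type near
`z`, and approximate extension brings it into `M`. The moves are geometrically small, so iterating
converges to an exact extension.

Exact extension is the one-point extension property. Back-and-forth on finite partial isomorphisms,
followed by closure in the product, gives homogeneity, universality and uniqueness. -/

namespace MetricStructure

/-! ### Types of families, embeddings and finite substructures -/

variable {L : ℕ → Type v} {A B C : MetricStructure.{u} L}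

/-- The family `a i ↦ b i` preserves the values of all predicate symbols. This is `TupleEmbeds`
for families with an arbitrary index type. -/
def SameType {ι : Type*} (a : ι → A) (b : ι → B) : Prop :=
  ∀ (m : ℕ) (P : PredSymbol L m) (s : Fin m → ι),
    B.interp P (fun i => b (s i)) = A.interp P (fun i => a (s i))

namespace SameType

variable {ι κ : Type*} {a : ι → A} {b : ι → B} {c : ι → C}

theorem refl (a : ι → A) : SameType a a := fun _ _ _ => rfl

theorem symm (h : SameType a b) : SameType b a := fun m P s => (h m P s).symm

theorem trans (h : SameType a b) (h' : SameType b c) : SameType a c :=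
  fun m P s => (h' m P s).trans (h m P s)

theorem reindex (h : SameType a b) (e : κ → ι) :
    SameType (fun i => a (e i)) (fun i => b (e i)) :=
  fun m P s => h m P fun i => e (s i)

theorem of_surjective {e : κ → ι} (he : Function.Surjective e)
    (h : SameType (fun i => a (e i)) (fun i => b (e i))) : SameType a b := by
  intro m P s
  have := h m P fun i => Function.surjInv he (s i)
  simpa only [Function.surjInv_eq he] using this

theorem dist_eq (h : SameType a b) (i j : ι) : dist (b i) (b j) = dist (a i) (a j) :=
  h 2 .metric ![i, j]

theorem eq_iff (h : SameType a b) (i j : ι) : b i = b j ↔ a i = a j := by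
  rw [← dist_eq_zero, h.dist_eq, dist_eq_zero]

theorem map (h : SameType a b) (f : Embedding B C) : SameType a (fun i => f (b i)) :=
  fun m P s => (f.map_interp P fun i => b (s i)).trans (h m P s)

/-- A family of the same type as the identity is an embedding. -/
def toEmbedding {f : A → B} (h : SameType (fun x : A => x) f) : Embedding A B where
  toFun := f
  map_interp P a := h _ P a

@[simp] theorem toEmbedding_apply {f : A → B} (h : SameType (fun x : A => x) f) (x : A) :
    h.toEmbedding x = f x := rfl

end SameType

namespace Embedding

theorem sameType (f : Embedding A B) {ι : Type*} (a : ι → A) : SameType a (fun i => f (a i)) :=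
  (SameType.refl a).map f

theorem dist_eq (f : Embedding A B) (x y : A) : dist (f x) (f y) = dist x y :=
  f.map_interp .metric ![x, y]

/-- The identity embedding. -/
protected def id (A : MetricStructure.{u} L) : Embedding A A where
  toFun x := x
  map_interp _ _ := rfl

/-- Composition of embeddings. -/
def comp (g : Embedding B C) (f : Embedding A B) : Embedding A C where
  toFun x := g (f x)
  map_interp P a := (g.map_interp P _).trans (f.map_interp P a)

end Embedding

/-- The family `a` with one further entry `w`. -/
def adjoin {ι α : Type*} (a : ι → α) (w : α) : Option ι → α
  | none => w
  | some i => a i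

@[simp] theorem adjoin_none {ι α : Type*} (a : ι → α) (w : α) : adjoin a w none = w := rfl

@[simp] theorem adjoin_some {ι α : Type*} (a : ι → α) (w : α) (i : ι) :
    adjoin a w (some i) = a i := rfl

theorem snoc_finSuccEquivLast_symm {n : ℕ} {α : Type*} (a : Fin n → α) (w : α)
    (i : Option (Fin n)) :
    (Fin.snoc a w : Fin (n + 1) → α) (finSuccEquivLast.symm i) = adjoin a w i := by
  cases i <;> simp

/-- The continuity of all interpretations, including that of the metric symbol. -/
theorem continuous_interp (A : MetricStructure.{u} L) {n : ℕ} (P : PredSymbol L n) :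
    Continuous (A.interp P) := by
  cases P with
  | metric => exact (continuous_apply 0).dist (continuous_apply 1)
  | other R => exact A.continuous_rel R

/-- The finite substructure of `A` with the given domain. -/
def finiteSubstructure (A : MetricStructure.{u} L) (S : Set A) (hS : S.Finite) :
    MetricStructure.{u} L where
  carrier := S
  complete := hS.isCompact.isComplete.completeSpace_coe
  rel R a := A.rel R fun i => (a i : A)
  continuous_rel R := (A.continuous_rel R).comp (by fun_prop)

/-- The inclusion of a finite substructure. -/
def finiteSubstructureIncl (A : MetricStructure.{u} L) (S : Set A) (hS : S.Finite) :
    Embedding (A.finiteSubstructure S hS) A where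
  toFun x := Subtype.val (p := fun y => y ∈ S) x
  map_interp P a := by cases P <;> rfl

end MetricStructure

namespace FraisseClass

open MetricStructure

variable {L : ℕ → Type v} {K : MetricStructure.{u} L → Prop}
  {A B C M : MetricStructure.{u} L}

/-- The finite substructure on the range works, repetitions allowed. This is how hypotheses on `K`
reach tuples of a `K`-structure. -/
theorem exists_sameType_mem {ι : Type*} [Finite ι] (hM : IsKStructure K M) (x : ι → M) :
    ∃ A, K A ∧ ∃ a : ι → A, SameType a x := by
  let S := M.finiteSubstructure (Set.range x) (Set.finite_range x)
  have hS : Finite S := (Set.finite_range x).to_subtype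
  refine ⟨S, hM S hS ⟨M.finiteSubstructureIncl _ _⟩, fun i => ⟨x i, i, rfl⟩, ?_⟩
  exact (M.finiteSubstructureIncl _ (Set.finite_range x)).sameType
    (fun i => (⟨x i, i, rfl⟩ : Set.range x))

/-- Only `0`-ary symbols have a value on an empty family, and a common extension forces these values
to agree. -/
theorem sameType_of_isEmpty {ι : Type*} [IsEmpty ι] (hJEP : JEP K) (hA : K A) (hB : K B)
    (a : ι → A) (b : ι → B) : SameType a b := by
  obtain ⟨C, -, ⟨f⟩, ⟨g⟩⟩ := hJEP A B hA hB
  refine ((f.sameType a).trans ?_).trans (g.sameType b).symm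
  intro m P s
  congr 1
  exact funext fun i => isEmptyElim (s i)

/-! ### Amalgamation from bounded amalgamation -/

section Amalgamation

theorem exists_one_point_amalgam (hBAP : BAP K) {ι : Type*} [Finite ι] [Nonempty ι]
    (hA : K A) (hB : K B) {a : ι → A} {b : ι → B} (h : SameType a b) (w : A) (z : B) :
    ∃ C, K C ∧ ∃ (c : ι → C) (w' z' : C),
      SameType (adjoin a w) (adjoin c w') ∧ SameType (adjoin b z) (adjoin c z') := by
  obtain ⟨n, ⟨e⟩⟩ := Finite.exists_equiv_fin ι
  have hn : 1 ≤ n := by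
    rcases n with _ | n
    · exact isEmptyElim (e (Classical.arbitrary ι))
    · omega
  obtain ⟨c, hc⟩ := hBAP n hn
  obtain ⟨C, hC, a', w', z', hx, hy, -⟩ :=
    hc ⟨A, hA, Fin.snoc (fun i => a (e.symm i)) w⟩ ⟨B, hB, Fin.snoc (fun i => b (e.symm i)) z⟩
      (by simp only [Fin.snoc_castSucc]; exact h.reindex e.symm)
  have key : ∀ {D : MetricStructure.{u} L} {d : ι → D} {x : D} {y : C},
      TupleEmbeds (Fin.snoc (fun i => d (e.symm i)) x : Fin (n + 1) → D)
        (Fin.snoc a' y : Fin (n + 1) → C) →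
      SameType (adjoin d x) (adjoin (fun i => a' (e i)) y) := by
    intro D d x y hxy
    have := SameType.reindex hxy fun o : Option ι => finSuccEquivLast.symm (o.map e)
    simp only [snoc_finSuccEquivLast_symm] at this
    convert this using 1 <;> funext o <;> cases o <;> simp
  exact ⟨C, hC, fun i => a' (e i), w', z', key hx, key hy⟩

/-- Amalgamate the points of `A` one by one with a structure containing `z`, over everything
adjoined so far. -/
theorem exists_one_point_extension (hBAP : BAP K) {ι : Type} [Finite ι] [Nonempty ι]
    (hfin : ∀ A : MetricStructure.{u} L, K A → Finite A)
    (hA : K A) (hB : K B) {a : ι → A} {b : ι → B} (h : SameType a b) (z : B) :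
    ∃ C, K C ∧ ∃ (f : Embedding A C) (z' : C),
      SameType (adjoin b z) (adjoin (fun i => f (a i)) z') := by
  -- `β` indexes the points of `A` already copied into `C`; the induction starts with `C = B`.
  have main : ∀ (β : Type u) [Finite β] (d : β → A), ∃ C, K C ∧ ∃ (c : ι ⊕ β → C) (z' : C),
      SameType (Sum.elim a d) c ∧ SameType (adjoin b z) (adjoin (fun i => c (.inl i)) z') := by
    intro β _
    induction β using Finite.induction_empty_option with
    | @of_equiv α β e ih =>
      intro d
      obtain ⟨C, hC, c, z', h₁, h₂⟩ := ih fun i => d (e i)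
      refine ⟨C, hC, fun i => c (i.map id e.symm), z', ?_, h₂⟩
      convert h₁.reindex (Sum.map id e.symm) using 1
      funext i
      cases i <;> simp
    | h_empty =>
      intro d
      refine ⟨B, hB, Sum.elim b isEmptyElim, z, ?_, .refl _⟩
      refine SameType.of_surjective (e := Sum.inl) ?_ h
      rintro (i | i)
      exacts [⟨i, rfl⟩, isEmptyElim i]
    | @h_option β _ ih =>
      intro d
      obtain ⟨C, hC, c, z', h₁, h₂⟩ := ih fun i => d (some i)
      obtain ⟨D, hD, c', w'', z'', h₃, h₄⟩ :=
        exists_one_point_amalgam hBAP hA hC h₁ (d none) z'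
      refine ⟨D, hD, Sum.elim (fun i => c' (.inl i)) (adjoin (fun j => c' (.inr j)) w''), z'', ?_,
        h₂.trans ?_⟩
      · convert h₃.reindex (Sum.elim (fun i => some (.inl i))
          (fun o => o.elim none fun j => some (.inr j)) : ι ⊕ Option β → Option (ι ⊕ β)) using 1
        all_goals
          funext i
          rcases i with i | _ | i <;> rfl
      · convert h₄.reindex (Option.map Sum.inl : Option ι → Option (ι ⊕ β)) using 1
        all_goals
          funext i
          rcases i with _ | i <;> rfl
  have := hfin A hA
  obtain ⟨C, hC, c, z', h₁, h₂⟩ := main A fun x => x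
  have h₃ : SameType (fun x : A => x) (fun x => c (.inr x)) := h₁.reindex Sum.inr
  refine ⟨C, hC, h₃.toEmbedding, z', h₂.trans ?_⟩
  have : ∀ i, c (.inr (a i)) = c (.inl i) := fun i => (h₁.eq_iff _ _).2 rfl
  simp only [SameType.toEmbedding_apply, this]
  exact .refl _

/-- Amalgamation of two members of `K` over tuples of the same type. -/
theorem exists_amalgam (hBAP : BAP K) (hJEP : JEP K) {ι : Type} [Finite ι]
    (hfin : ∀ A : MetricStructure.{u} L, K A → Finite A)
    (hA : K A) (hB : K B) {a : ι → A} {b : ι → B} (h : SameType a b) :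
    ∃ C, K C ∧ ∃ (f : Embedding A C) (g : Embedding B C), ∀ i, f (a i) = g (b i) := by
  rcases isEmpty_or_nonempty ι with hι | hι
  · obtain ⟨C, hC, ⟨f⟩, ⟨g⟩⟩ := hJEP A B hA hB
    exact ⟨C, hC, f, g, isEmptyElim⟩
  have hBfin := hfin B hB
  -- The points of `B` are adjoined to `A` one by one. They are indexed by `Fin N` because the
  -- one-point extension takes index types in `Type`, while `B` lies in `Type u`.
  obtain ⟨N, ⟨e⟩⟩ := Finite.exists_equiv_fin B
  have main : ∀ (β : Type) [Finite β] (d : β → B), ∃ C, K C ∧ ∃ (f : Embedding A C) (c : β → C),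
      SameType (Sum.elim b d) (Sum.elim (fun i => f (a i)) c) := by
    intro β _
    induction β using Finite.induction_empty_option with
    | @of_equiv α β e ih =>
      intro d
      obtain ⟨C, hC, f, c, h₁⟩ := ih fun i => d (e i)
      refine ⟨C, hC, f, fun i => c (e.symm i), ?_⟩
      convert h₁.reindex (Sum.map id e.symm) using 1
      all_goals
        funext i
        cases i <;> simp
    | h_empty =>
      intro d
      refine ⟨A, hA, .id A, isEmptyElim, ?_⟩
      refine SameType.of_surjective (e := Sum.inl) ?_ h.symm
      rintro (i | i)
      exacts [⟨i, rfl⟩, isEmptyElim i]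
    | @h_option β _ ih =>
      intro d
      obtain ⟨C, hC, f, c, h₁⟩ := ih fun i => d (some i)
      obtain ⟨D, hD, g, z', h₂⟩ :=
        exists_one_point_extension hBAP hfin hC hB h₁.symm (d none)
      refine ⟨D, hD, g.comp f, adjoin (fun j => g (c j)) z', ?_⟩
      convert h₂.reindex (Sum.elim (fun i => some (.inl i))
        (fun o => o.elim none fun j => some (.inr j)) : ι ⊕ Option β → Option (ι ⊕ β)) using 1
      all_goals
        funext i
        rcases i with i | _ | i <;> rfl
  obtain ⟨C, hC, f, c, h₁⟩ := main (Fin N) e.symm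
  have h₂ : SameType (fun x : B => x) (fun x => c (e x)) := by
    simpa using h₁.reindex fun x : B => Sum.inr (e x)
  refine ⟨C, hC, f, h₂.toEmbedding, fun i => ?_⟩
  -- The point `b i` occurs twice in the family on the side of `B`; families of the same type have
  -- the same coincidences.
  exact (h₁.eq_iff (.inl i) (.inr (e (b i)))).2 (by simp)

theorem ap_of_bap (hBAP : BAP K) (hJEP : JEP K)
    (hfin : ∀ A : MetricStructure.{u} L, K A → Finite A) : AP K := by
  intro A B C hA hB hC fB fC
  have := hfin A hA
  obtain ⟨n, ⟨e⟩⟩ := Finite.exists_equiv_fin A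
  obtain ⟨D, hD, f, g, hfg⟩ := exists_amalgam hBAP hJEP hfin hB hC
    ((fB.sameType e.symm).symm.trans (fC.sameType e.symm))
  exact ⟨D, hD, f, g, fun x => by simpa using hfg (e x)⟩

end Amalgamation

end FraisseClass

/-! ### Closeness of types and the pseudometric `d_K` -/

namespace FraisseClass

open MetricStructure Filter Topology

variable {L : ℕ → Type v} {K : MetricStructure.{u} L → Prop}
  {A B C M N : MetricStructure.{u} L}

/-- AP over the finite substructure on the range of `a`, which maps to `B` by `a i ↦ b i`. -/
theorem IsFraisse.exists_amalgam (hK : IsFraisse K) {ι : Type*} [Finite ι]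
    (hA : K A) (hB : K B) {a : ι → A} {b : ι → B} (h : SameType a b) :
    ∃ C, K C ∧ ∃ (f : Embedding A C) (g : Embedding B C), ∀ i, f (a i) = g (b i) := by
  have hfinite := Set.finite_range a
  let S := A.finiteSubstructure (Set.range a) hfinite
  let s : ι → S := fun i => ⟨a i, i, rfl⟩
  let inc : Embedding S A := A.finiteSubstructureIncl (Set.range a) hfinite
  have hS : Finite S := hfinite.to_subtype
  choose r hr using fun x : S => x.2
  have hinc : SameType (fun x : S => x) (fun x => a (r x)) := by
    have := inc.sameType fun x : S => x
    convert this using 1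
    exact funext hr
  have hb : SameType (fun x : S => x) (fun x => b (r x)) := hinc.trans (h.reindex r)
  obtain ⟨C, hC, f, g, hfg⟩ := hK.ap S A B (hK.hp A hA S hS ⟨inc⟩) hA hB inc hb.toEmbedding
  refine ⟨C, hC, f, g, fun i => (hfg (s i)).trans ?_⟩
  congr 1
  exact (h.eq_iff _ _).2 (hr (s i))

/-- The families `a` and `b` have images in a common structure in `K` at distance less than `δ`. -/
def Near (K : MetricStructure.{u} L → Prop) (δ : ℝ) {ι : Type*} (a : ι → A) (b : ι → B) : Prop :=
  ∃ C, K C ∧ ∃ a' b' : ι → C, SameType a a' ∧ SameType b b' ∧ ∀ i, dist (a' i) (b' i) < δ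

namespace Near

variable {ι κ : Type*} {δ ε : ℝ} {a : ι → A} {b : ι → B} {c : ι → C}

theorem symm (h : Near K δ a b) : Near K δ b a := by
  obtain ⟨C, hC, a', b', ha, hb, hab⟩ := h
  exact ⟨C, hC, b', a', hb, ha, fun i => by simpa only [dist_comm] using hab i⟩

theorem congr_right (h : Near K δ a b) (hbc : SameType b c) : Near K δ a c := by
  obtain ⟨C, hC, a', b', ha, hb, hab⟩ := h
  exact ⟨C, hC, a', b', ha, hbc.symm.trans hb, hab⟩

theorem congr_left (h : Near K δ a b) (hac : SameType a c) : Near K δ c b :=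
  (h.symm.congr_right hac).symm

theorem reindex (h : Near K δ a b) (e : κ → ι) :
    Near K δ (fun i => a (e i)) (fun i => b (e i)) := by
  obtain ⟨C, hC, a', b', ha, hb, hab⟩ := h
  exact ⟨C, hC, _, _, ha.reindex e, hb.reindex e, fun i => hab (e i)⟩

theorem mono (h : Near K δ a b) (hδ : δ ≤ ε) : Near K ε a b := by
  obtain ⟨C, hC, a', b', ha, hb, hab⟩ := h
  exact ⟨C, hC, a', b', ha, hb, fun i => (hab i).trans_le hδ⟩

/-- The triangle inequality of `d_K`: amalgamate the two witnesses over their copies of `b`. -/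
theorem trans [Finite ι] (hK : IsFraisse K) (h : Near K δ a b) (h' : Near K ε b c) :
    Near K (δ + ε) a c := by
  obtain ⟨D, hD, a', b', ha, hb, hab⟩ := h
  obtain ⟨E, hE, b'', c', hb', hc, hbc⟩ := h'
  obtain ⟨F, hF, f, g, hfg⟩ := hK.exists_amalgam hD hE (hb.symm.trans hb')
  refine ⟨F, hF, fun i => f (a' i), fun i => g (c' i), ha.map f, hc.map g, fun i => ?_⟩
  calc dist (f (a' i)) (g (c' i)) ≤ dist (f (a' i)) (f (b' i)) + dist (f (b' i)) (g (c' i)) :=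
        dist_triangle _ _ _
    _ = dist (a' i) (b' i) + dist (b'' i) (c' i) := by rw [f.dist_eq, hfg, g.dist_eq]
    _ < δ + ε := add_lt_add (hab i) (hbc i)

theorem of_dist_lt [Finite ι] (hM : IsKStructure K M) {x y : ι → M}
    (h : ∀ i, dist (x i) (y i) < δ) : Near K δ x y := by
  obtain ⟨A, hA, a, ha⟩ := exists_sameType_mem hM (Sum.elim x y)
  refine ⟨A, hA, fun i => a (.inl i), fun i => a (.inr i), (ha.reindex Sum.inl).symm,
    (ha.reindex Sum.inr).symm, fun i => ?_⟩
  exact (ha.dist_eq (.inl i) (.inr i)).symm.trans_lt (h i)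

end Near

/-- An infimum is below a bound exactly when some witness is, and a finite supremum when all entries
are; for the empty tuple the supremum is `0`, whence `0 < δ`. -/
theorem near_iff_distK_lt {n : ℕ} {a b : Enumerated K n} {δ : ℝ} (hδ : 0 < δ) :
    Near K δ a.tuple b.tuple ↔ distK a b < ENNReal.ofReal δ := by
  have hδ' : (0 : ℝ≥0∞) < ENNReal.ofReal δ := ENNReal.ofReal_pos.2 hδ
  have key : ∀ {C : MetricStructure.{u} L} (a' b' : Fin n → C),
      (⨆ i, edist (a' i) (b' i)) < ENNReal.ofReal δ ↔ ∀ i, dist (a' i) (b' i) < δ := by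
    intro C a' b'
    rw [← Finset.sup_univ_eq_iSup, Finset.sup_lt_iff (by simpa using hδ)]
    simp [edist_lt_ofReal]
  simp only [distK, iInf_lt_iff, key, Near]
  constructor
  · rintro ⟨C, hC, a', b', ha, hb, h⟩
    exact ⟨C, hC, a', b', ha, hb, h⟩
  · rintro ⟨C, hC, a', b', ha, hb, h⟩
    exact ⟨C, hC, a', b', ha, hb, h⟩

theorem exists_ofReal_le {δ : ℝ≥0∞} (hδ : 0 < δ) : ∃ r : ℝ, 0 < r ∧ ENNReal.ofReal r ≤ δ := by
  obtain ⟨r, hr, hr'⟩ := ENNReal.lt_iff_exists_nnreal_btwn.1 hδ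
  exact ⟨r, by exact_mod_cast hr, by simpa using hr'.le⟩

theorem CP.exists_near (hCP : CP K) {n : ℕ} (P : PredSymbol L n) (hA : K A) (a : Fin n → A)
    {ε : ℝ} (hε : 0 < ε) :
    ∃ δ : ℝ, 0 < δ ∧ ∀ (B : MetricStructure.{u} L) (b : Fin n → B), Near K δ a b →
      |A.interp P a - B.interp P b| < ε := by
  obtain ⟨δ, hδ, h⟩ := hCP n P ⟨A, hA, a⟩ ε hε
  obtain ⟨r, hr, hr'⟩ := exists_ofReal_le hδ
  refine ⟨r, hr, fun B b hab => ?_⟩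
  obtain ⟨C, hC, a', b', ha, hb, hab'⟩ := id hab
  have := h ⟨C, hC, b'⟩ (((near_iff_distK_lt hr).1 (hab.congr_right hb)).trans_le hr')
  rwa [show B.interp P b = C.interp P b' from (hb n P id).symm]

theorem CP.tendsto_interp (hCP : CP K) {ι κ : Type*} {l : Filter κ} (hA : K A) (a : ι → A)
    {B : κ → MetricStructure.{u} L} (b : ∀ k, ι → B k)
    (h : ∀ ε : ℝ, 0 < ε → ∀ᶠ k in l, Near K ε a (b k))
    {m : ℕ} (P : PredSymbol L m) (s : Fin m → ι) :
    Tendsto (fun k => (B k).interp P fun i => b k (s i)) l (𝓝 (A.interp P fun i => a (s i))) := by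
  rw [Metric.tendsto_nhds]
  intro ε hε
  obtain ⟨δ, hδ, hab⟩ := hCP.exists_near P hA (fun i => a (s i)) hε
  filter_upwards [h δ hδ] with k hk
  rw [dist_comm, Real.dist_eq]
  exact hab _ _ (hk.reindex s)

theorem PP.exists_countable (hPP : PP K) (n : ℕ) :
    ∃ S : Set (Enumerated K n), S.Countable ∧
      ∀ (A : MetricStructure.{u} L), K A → ∀ (a : Fin n → A) (ε : ℝ), 0 < ε →
        ∃ s ∈ S, Near K ε a s.tuple := by
  obtain ⟨⟨S, hS, h⟩, -⟩ := hPP n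
  refine ⟨S, hS, fun A hA a ε hε => ?_⟩
  obtain ⟨s, hs, hs'⟩ := h ⟨A, hA, a⟩ _ (ENNReal.ofReal_pos.2 hε)
  exact ⟨s, hs, (near_iff_distK_lt hε).2 hs'⟩

theorem PP.exists_limit (hPP : PP K) {n : ℕ} (x : ℕ → Enumerated K n)
    (hx : ∀ ε : ℝ, 0 < ε → ∃ N, ∀ i ≥ N, ∀ j ≥ N, Near K ε (x i).tuple (x j).tuple) :
    ∃ b : Enumerated K n, ∀ ε : ℝ, 0 < ε → ∀ᶠ k in atTop, Near K ε (x k).tuple b.tuple := by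
  obtain ⟨b, hb⟩ := (hPP n).2 x fun ε hε => by
    obtain ⟨r, hr, hr'⟩ := exists_ofReal_le hε
    obtain ⟨N, hN⟩ := hx r hr
    exact ⟨N, fun i hi j hj => ((near_iff_distK_lt hr).1 (hN i hi j hj)).trans_le hr'⟩
  refine ⟨b, fun ε hε => ?_⟩
  obtain ⟨N, hN⟩ := hb _ (ENNReal.ofReal_pos.2 hε)
  exact eventually_atTop.2 ⟨N, fun k hk => (near_iff_distK_lt hε).2 (hN k hk)⟩

/-! ### Completing a space whose finite families are realized in `K` -/

section Completion

open UniformSpace (Completion)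

variable {X : Type u} [PseudoMetricSpace X] {R : ∀ {n : ℕ}, L n → (Fin n → X) → ℝ}

/-- The family `a` in the structure `A` has the distances and the values of predicate symbols of the
family `x` in the space `X` with predicates `R`. -/
def Realizes (R : ∀ {n : ℕ}, L n → (Fin n → X) → ℝ) {ι : Type*} (x : ι → X) (a : ι → A) : Prop :=
  (∀ i j, dist (a i) (a j) = dist (x i) (x j)) ∧
    ∀ (m : ℕ) (P : L m) (s : Fin m → ι), A.rel P (fun i => a (s i)) = R P fun i => x (s i)

theorem Realizes.reindex {ι κ : Type*} {x : ι → X} {a : ι → A} (h : Realizes R x a) (e : κ → ι) :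
    Realizes R (fun i => x (e i)) (fun i => a (e i)) :=
  ⟨fun i j => h.1 (e i) (e j), fun m P s => h.2 m P fun i => e (s i)⟩

theorem Realizes.sameType {ι : Type*} {x : ι → X} {a : ι → A} {b : ι → B} (h : Realizes R x a)
    (h' : Realizes R x b) : SameType a b := by
  intro m P s
  cases P with
  | metric => exact (h'.1 _ _).trans (h.1 _ _).symm
  | other P => exact (h'.2 _ P s).trans (h.2 _ P s).symm

variable (hX : ∀ {n : ℕ} (x : Fin n → X), ∃ A, K A ∧ ∃ a : Fin n → A, Realizes R x a)

include hX in
-- Realize `x` and `y` together, as one tuple of length `n + n`.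
theorem Realizes.near {n : ℕ} {x y : Fin n → X} {a : Fin n → A} {b : Fin n → B}
    (ha : Realizes R x a) (hb : Realizes R y b) {δ : ℝ} (h : ∀ i, dist (x i) (y i) < δ) :
    Near K δ a b := by
  obtain ⟨C, hC, c, hc⟩ := hX fun i => Sum.elim x y (finSumFinEquiv.symm i)
  have hc' : Realizes R (Sum.elim x y) fun i => c (finSumFinEquiv i) := by
    simpa using hc.reindex (finSumFinEquiv : Fin n ⊕ Fin n → Fin (n + n))
  refine ⟨C, hC, _, _, ha.sameType (hc'.reindex Sum.inl), hb.sameType (hc'.reindex Sum.inr), ?_⟩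
  exact fun i => (hc'.1 (.inl i) (.inr i)).trans_lt (h i)

theorem exists_seq_dist_lt {n : ℕ} (x : Fin n → Completion X) :
    ∃ y : ℕ → Fin n → X, ∀ k i, dist (y k i : Completion X) (x i) < 1 / ((k : ℝ) + 1) := by
  have : ∀ (k : ℕ) (i : Fin n), ∃ y : X, dist (y : Completion X) (x i) < 1 / ((k : ℝ) + 1) := by
    intro k i
    obtain ⟨y, hy⟩ := Completion.denseRange_coe.exists_dist_lt (x i)
      (ε := 1 / ((k : ℝ) + 1)) (by positivity)
    exact ⟨y, by rwa [dist_comm]⟩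
  choose y hy using this
  exact ⟨y, hy⟩

include hX in
-- Types of approximants to `x` are `d_K`-Cauchy, so PP provides a limit `b`. It serves as the type
-- of `x`, whichever approximants are used.
theorem exists_limit_type (hK : IsFraisse K) {n : ℕ} (x : Fin n → Completion X) :
    ∃ b : Enumerated K n, ∀ δ : ℝ, 0 < δ → ∃ δ' : ℝ, 0 < δ' ∧ ∀ y : Fin n → X,
      (∀ i, dist (y i : Completion X) (x i) < δ') →
      ∀ (A : MetricStructure.{u} L) (a : Fin n → A), Realizes R y a → Near K δ b.tuple a := by
  obtain ⟨y, hy⟩ := exists_seq_dist_lt x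
  choose A hA a ha using fun k => hX (y k)
  have hlim : ∀ ε : ℝ, 0 < ε → ∀ᶠ k : ℕ in atTop, 1 / ((k : ℝ) + 1) < ε := fun ε hε =>
    tendsto_one_div_add_atTop_nhds_zero_nat.eventually_lt_const hε
  have hclose : ∀ {ε : ℝ} {y z : Fin n → X}, (∀ i, dist (y i : Completion X) (x i) < ε / 2) →
      (∀ i, dist (z i : Completion X) (x i) < ε / 2) → ∀ i, dist (y i) (z i) < ε := by
    intro ε y z hy hz i
    rw [← Completion.dist_eq]
    have := dist_triangle_right (y i : Completion X) (z i) (x i)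
    linarith [hy i, hz i]
  obtain ⟨b, hb⟩ := hK.pp.exists_limit (fun k => ⟨A k, hA k, a k⟩) fun ε hε => by
    obtain ⟨N, hN⟩ := eventually_atTop.1 (hlim (ε / 2) (half_pos hε))
    exact ⟨N, fun i hi j hj => (ha i).near hX (ha j)
      (hclose (fun k => (hy i k).trans (hN i hi)) fun k => (hy j k).trans (hN j hj))⟩
  -- Two approximants within `δ / 4` of `x` are within `δ / 2` of each other; the other `δ / 2` is
  -- for the distance from a late term to `b`.
  refine ⟨b, fun δ hδ => ⟨δ / 2 / 2, by positivity, fun z hz B c hc => ?_⟩⟩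
  obtain ⟨k, hk, hk'⟩ := ((hb (δ / 2) (half_pos hδ)).and
    (hlim (δ / 2 / 2) (by positivity))).exists
  have := hk.symm.trans hK ((ha k).near hX hc (hclose (fun i => (hy k i).trans hk') hz))
  exact this.mono (by linarith)

theorem isDenseInducing_map_coe (n : ℕ) :
    IsDenseInducing (Pi.map fun _ x => x : (Fin n → X) → Fin n → Completion X) :=
  ⟨.piMap fun _ => (Completion.isUniformInducing_coe X).isInducing,
    .piMap fun _ => Completion.denseRange_coe⟩

include hX in
-- By CP, values at approximants converge to the value at the limit type. This replaces uniform
-- continuity of `R`.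
theorem exists_tendsto_rel (hK : IsFraisse K) {n : ℕ} (P : L n) (x : Fin n → Completion X) :
    ∃ c : ℝ, Tendsto (R P)
      (comap (Pi.map fun _ x => x : (Fin n → X) → Fin n → Completion X) (𝓝 x)) (𝓝 c) := by
  obtain ⟨b, hb⟩ := exists_limit_type hX hK x
  refine ⟨b.ambient.rel P b.tuple, ?_⟩
  choose A hA a ha using fun y : Fin n → X => hX y
  have := hK.cp.tendsto_interp b.mem b.tuple
    (l := comap (Pi.map fun _ x => x : (Fin n → X) → Fin n → Completion X) (𝓝 x)) (B := A) a
    (fun ε hε => by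
      obtain ⟨δ, hδ, h⟩ := hb ε hε
      filter_upwards [preimage_mem_comap (Metric.ball_mem_nhds x hδ)] with y hy
      exact h y (fun i => (dist_pi_lt_iff hδ).1 hy i) _ _ (ha y)) (.other P) id
  refine this.congr fun y => ?_
  exact (ha y).2 n P id

/-- The completion of a space all of whose finite families are realized in `K`. -/
noncomputable def completion (hK : IsFraisse K) : MetricStructure.{u} L where
  carrier := Completion X
  rel P := (isDenseInducing_map_coe _).extend (R P)
  continuous_rel P := (isDenseInducing_map_coe _).continuous_extend (exists_tendsto_rel hX hK P)

/-- The canonical map of a space into its completion. -/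
def toCompletion (hK : IsFraisse K) (x : X) : completion hX hK := (x : Completion X)

theorem denseRange_toCompletion (hK : IsFraisse K) : DenseRange (toCompletion hX hK) :=
  Completion.denseRange_coe (α := X)

theorem continuous_toCompletion (hK : IsFraisse K) : Continuous (toCompletion hX hK) :=
  Completion.continuous_coe X

theorem Realizes.sameType_completion (hK : IsFraisse K) {ι : Type*} {x : ι → X} {a : ι → A}
    (h : Realizes R x a) :
    SameType a (fun i => toCompletion hX hK (x i)) := by
  intro m P s
  cases P with
  | metric => exact (Completion.dist_eq _ _).trans (h.1 _ _).symm
  | other P =>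
    refine Eq.trans ?_ (h.2 m P s).symm
    obtain ⟨c, hc⟩ := exists_tendsto_rel hX hK P fun i => (x (s i) : Completion X)
    have h₁ := (isDenseInducing_map_coe _).extend_eq_of_tendsto hc
    -- The filter defining the extension is coarser than `pure` at the point, so the limit must be
    -- the value there; continuity of `R` is not presupposed.
    have h₂ : Tendsto (R P) (pure fun i => x (s i)) (𝓝 c) := hc.mono_left <| by
      rw [pure_le_iff]
      rintro t ⟨t', ht', ht⟩
      exact ht (mem_of_mem_nhds ht' : _)
    exact h₁.trans (tendsto_nhds_unique h₂ (tendsto_pure_nhds _ _))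

/-- Values at the approximants converge to those at `x` by continuity in the completion, and to
those at the limit type by CP. -/
theorem exists_sameType_completion (hK : IsFraisse K) {n : ℕ} (x : Fin n → completion hX hK) :
    ∃ b : Enumerated K n, SameType b.tuple x := by
  obtain ⟨b, hb⟩ := exists_limit_type hX hK x
  refine ⟨b, fun m P s => ?_⟩
  obtain ⟨y, hy⟩ := exists_seq_dist_lt x
  choose A hA a ha using fun k => hX (y k)
  have hlim : ∀ ε : ℝ, 0 < ε → ∀ᶠ k : ℕ in atTop, 1 / ((k : ℝ) + 1) < ε := fun ε hε =>
    tendsto_one_div_add_atTop_nhds_zero_nat.eventually_lt_const hε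
  have h₁ := hK.cp.tendsto_interp b.mem b.tuple (l := atTop) (B := A) a
    (fun ε hε => by
      obtain ⟨δ, hδ, h⟩ := hb ε hε
      filter_upwards [hlim δ hδ] with k hk
      exact h _ (fun i => (hy k i).trans hk) _ _ (ha k)) P s
  have h₂ : Tendsto (fun k i => (y k (s i) : Completion X)) atTop (𝓝 fun i => x (s i)) := by
    refine tendsto_pi_nhds.2 fun i => tendsto_iff_dist_tendsto_zero.2 ?_
    exact squeeze_zero (fun _ => dist_nonneg) (fun k => (hy k (s i)).le)
      tendsto_one_div_add_atTop_nhds_zero_nat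
  have h₃ := (((completion hX hK).continuous_interp P).tendsto _).comp h₂
  refine tendsto_nhds_unique h₃ (h₁.congr fun k => ?_)
  exact ((ha k).sameType_completion hX hK m P s).symm

theorem isSeparableKStructure_completion (hK : IsFraisse K) [Countable X] :
    IsSeparableKStructure K (completion hX hK) := by
  constructor
  · exact (TopologicalSpace.SeparableSpace.of_denseRange _ (denseRange_toCompletion hX hK))
  · rintro B hB ⟨f⟩
    obtain ⟨n, ⟨e⟩⟩ := Finite.exists_equiv_fin B
    obtain ⟨b, hb⟩ := exists_sameType_completion hX hK fun i => f (e.symm i)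
    have : SameType (fun x : B => x) (fun x => b.tuple (e x)) := by
      simpa using ((f.sameType e.symm).trans hb.symm).reindex e
    exact hK.hp _ b.mem B hB ⟨this.toEmbedding⟩

end Completion

/-! ### Existence of an approximate limit by a generic sequence -/

/-- A member of `K` with a sequence of elements, of which the first `size` ones are relevant. -/
structure Condition (K : MetricStructure.{u} L → Prop) where
  size : ℕ
  ambient : MetricStructure.{u} L
  mem : K ambient
  tuple : ℕ → ambient

/-- A condition is extended by those with more relevant elements and the same values of predicate
symbols on the old ones. -/
instance : Preorder (Condition K) where
  le p q := p.size ≤ q.size ∧ SameType (fun i : Fin p.size => p.tuple i) (fun i => q.tuple i)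
  le_refl p := ⟨le_rfl, .refl _⟩
  le_trans p q r hpq hqr :=
    ⟨hpq.1.trans hqr.1, hpq.2.trans (hqr.2.reindex (Fin.castLE hpq.1))⟩

namespace Condition

theorem sameType_of_le {p q : Condition K} (h : p ≤ q) {ι : Type*} {x : ι → ℕ}
    (hx : ∀ i, x i < p.size) : SameType (fun i => p.tuple (x i)) (fun i => q.tuple (x i)) :=
  h.2.reindex fun i => ⟨x i, hx i⟩

theorem sameType_of_mem {I : Order.Ideal (Condition K)} {p q : Condition K} (hp : p ∈ I)
    (hq : q ∈ I) {ι : Type*} {x : ι → ℕ} (hxp : ∀ i, x i < p.size) (hxq : ∀ i, x i < q.size) :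
    SameType (fun i => p.tuple (x i)) (fun i => q.tuple (x i)) := by
  obtain ⟨r, -, hpr, hqr⟩ := I.directed p hp q hq
  exact (sameType_of_le hpr hxp).trans (sameType_of_le hqr hxq).symm

/-- The enumerated structure `s` and the family `y` have images in a common structure in `K` such
that the image of `s (e i)` is within `δ` of that of `y i`. -/
def Compatible {N n : ℕ} (s : Enumerated K N) (e : Fin n → Fin N) (y : Fin n → A) (δ : ℝ) : Prop :=
  ∃ E, K E ∧ ∃ (s' : Fin N → E) (y' : Fin n → E), SameType s.tuple s' ∧ SameType y y' ∧
    ∀ i, dist (s' (e i)) (y' i) < δ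

/-- The condition `p` meets the requirement to contain a copy of `s` near `y`, if this is possible
at all. -/
def Meets {N n : ℕ} (s : Enumerated K N) (e : Fin n → Fin N) (y : Fin n → ℕ) (δ : ℝ)
    (p : Condition K) : Prop :=
  (∀ i, y i < p.size) ∧ (Compatible s e (fun i => p.tuple (y i)) δ →
    ∃ t : Fin N → ℕ, (∀ i, t i < p.size) ∧ SameType s.tuple (fun i => p.tuple (t i)) ∧
      ∀ i, dist (p.tuple (t (e i))) (p.tuple (y i)) < δ)

/-- If compatible, amalgamate the ambient structure with a witness over the tuple indexed by `y` and
append the copy of `s`; otherwise the requirement is vacuous once all `y i` are relevant. -/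
theorem exists_le_meets (hK : IsFraisse K) {N n : ℕ} (s : Enumerated K N) (e : Fin n → Fin N)
    (y : Fin n → ℕ) (δ : ℝ) (p₀ : Condition K) : ∃ p, Meets s e y δ p ∧ p₀ ≤ p := by
  obtain ⟨k, hk₀, hk⟩ : ∃ k, p₀.size ≤ k ∧ ∀ i, y i < k :=
    ⟨p₀.size + ∑ i, (y i + 1), by omega, fun i => by
      have := Finset.single_le_sum (f := fun i => y i + 1) (fun _ _ => Nat.zero_le _)
        (Finset.mem_univ i)
      omega⟩
  let p : Condition K := ⟨k, p₀.ambient, p₀.mem, p₀.tuple⟩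
  have hp : p₀ ≤ p := ⟨hk₀, .refl _⟩
  by_cases h : Compatible s e (fun i => p.tuple (y i)) δ
  swap
  · exact ⟨p, ⟨hk, fun h' => absurd h' h⟩, hp⟩
  obtain ⟨E, hE, s', y', hs, hy, hd⟩ := h
  obtain ⟨D, hD, f, g, hfg⟩ := hK.exists_amalgam p.mem hE hy
  let q : Condition K := ⟨k + N, D, hD, fun i =>
    if h : k ≤ i ∧ i - k < N then g (s' ⟨i - k, h.2⟩) else f (p.tuple i)⟩
  have hq₁ : ∀ i, i < k → q.tuple i = f (p.tuple i) := fun i hi => dif_neg (by omega)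
  have hq₂ : ∀ i : Fin N, q.tuple (k + i) = g (s' i) := fun i => by
    simp only [q]
    rw [dif_pos (by omega)]
    simp
  refine ⟨q, ⟨fun i => (hk i).trans_le (Nat.le_add_right _ _), fun _ =>
    ⟨fun i => k + i, fun i => Nat.add_lt_add_left i.2 k, ?_, fun i => ?_⟩⟩,
    hp.trans ⟨Nat.le_add_right _ _, ?_⟩⟩
  · simp only [hq₂]
    exact hs.map g
  · rw [hq₂, hq₁ _ (hk i), hfg, g.dist_eq]
    exact hd i
  · have : ∀ i : Fin p.size, q.tuple i = f (p.tuple i) := fun i => hq₁ i i.2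
    simp only [this]
    exact f.sameType _

end Condition

/-- A point of the dense countable subset of a generic structure. -/
structure GenericPoint : Type u where
  index : ℕ

instance : Countable GenericPoint.{u} :=
  (show Function.Injective GenericPoint.index from fun ⟨_⟩ ⟨_⟩ h => congrArg _ h).countable

/-- Distances and values are read off any sufficiently long condition in `I`; directedness makes the
choice irrelevant. The structure is the completion of the resulting countable space. -/
theorem exists_kStructure_of_ideal (hK : IsFraisse K) (I : Order.Ideal (Condition K))
    (hI : ∀ n, ∃ p ∈ I, n < p.size) :
    ∃ M, IsSeparableKStructure K M ∧ ∃ g : ℕ → M, DenseRange g ∧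
      ∀ p ∈ I, SameType (fun i : Fin p.size => p.tuple i) (fun i => g i) := by
  choose q hqI hq using hI
  let ρ : GenericPoint.{u} → GenericPoint.{u} → ℝ := fun x y =>
    dist ((q (max x.index y.index)).tuple x.index) ((q (max x.index y.index)).tuple y.index)
  have hρ : ∀ p ∈ I, ∀ x y : GenericPoint.{u}, x.index < p.size → y.index < p.size →
      ρ x y = dist (p.tuple x.index) (p.tuple y.index) := by
    intro p hp x y hx hy
    refine (Condition.sameType_of_mem hp (hqI (max x.index y.index))
      (x := ![x.index, y.index]) ?_ ?_).dist_eq 0 1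
    · simpa [Fin.forall_fin_two] using ⟨hx, hy⟩
    · simpa [Fin.forall_fin_two] using ⟨(le_max_left _ _).trans_lt (hq _),
        (le_max_right _ _).trans_lt (hq _)⟩
  have hbound : ∀ {ι : Type} [Fintype ι] (x : ι → GenericPoint.{u}),
      ∃ p ∈ I, ∀ i, (x i).index < p.size := fun x =>
    ⟨_, hqI (Finset.univ.sup fun i => (x i).index),
      fun i => (Finset.le_sup (f := fun i => (x i).index) (Finset.mem_univ i)).trans_lt (hq _)⟩
  let : PseudoMetricSpace GenericPoint.{u} :=
    { dist := ρ
      dist_self := fun x => dist_self _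
      dist_comm := fun x y => by
        obtain ⟨p, hp, h⟩ := hbound ![x, y]
        rw [hρ p hp x y (h 0) (h 1), hρ p hp y x (h 1) (h 0), dist_comm]
      dist_triangle := fun x y z => by
        obtain ⟨p, hp, h⟩ := hbound ![x, y, z]
        rw [hρ p hp x y (h 0) (h 1), hρ p hp x z (h 0) (h 2), hρ p hp y z (h 1) (h 2)]
        exact dist_triangle _ _ _ }
  let R : ∀ {n : ℕ}, L n → (Fin n → GenericPoint.{u}) → ℝ := fun P x =>
    (q (Finset.univ.sup fun i => (x i).index)).ambient.rel P fun i =>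
      (q (Finset.univ.sup fun i => (x i).index)).tuple (x i).index
  have hR : ∀ p ∈ I, ∀ {ι : Type} (x : ι → GenericPoint.{u}), (∀ i, (x i).index < p.size) →
      Realizes R x (fun i => p.tuple (x i).index) := by
    intro p hp ι x hx
    refine ⟨fun i j => (hρ p hp _ _ (hx i) (hx j)).symm, fun m P s => ?_⟩
    refine Condition.sameType_of_mem (hqI _) hp
      (x := fun i => (x (s i)).index) (fun i => ?_) (fun i => hx _) m (.other P) id
    exact (Finset.le_sup (f := fun i => (x (s i)).index) (Finset.mem_univ i)).trans_lt (hq _)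
  have hX : ∀ {n : ℕ} (x : Fin n → GenericPoint.{u}),
      ∃ A, K A ∧ ∃ a : Fin n → A, Realizes R x a := by
    intro n x
    obtain ⟨p, hp, h⟩ := hbound x
    exact ⟨p.ambient, p.mem, _, hR p hp x h⟩
  refine ⟨completion hX hK, isSeparableKStructure_completion hX hK,
    fun i => toCompletion hX hK ⟨i⟩, ?_, fun p hp => ?_⟩
  · have : Function.Surjective (GenericPoint.mk : ℕ → GenericPoint.{u}) := fun x => ⟨x.index, rfl⟩
    exact (denseRange_toCompletion hX hK).comp this.denseRange
      (continuous_toCompletion hX hK)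
  · exact (hR p hp (fun i : Fin p.size => ⟨i⟩) fun i => i.2).sameType_completion hX hK

theorem exists_seq_of_step {α : Type*} {P : ℕ → α → Prop} {Q : ℕ → α → α → Prop}
    {a₀ : α} (h₀ : P 0 a₀) (h : ∀ n a, P n a → ∃ b, P (n + 1) b ∧ Q n a b) :
    ∃ f : ℕ → α, f 0 = a₀ ∧ (∀ n, P n (f n)) ∧ ∀ n, Q n (f n) (f (n + 1)) := by
  choose! g hg hg' using h
  let f : ℕ → α := fun n => Nat.rec a₀ g n
  have hf : ∀ n, P n (f n) := fun n => by
    induction n with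
    | zero => exact h₀
    | succ n ih => exact hg n _ ih
  exact ⟨f, rfl, hf, fun n => hg' n _ (hf n)⟩

theorem mem_of_isKStructure [Finite B] (hB : IsKStructure K B) : K B :=
  hB B ‹_› ⟨.id B⟩

/-- Amalgamate a witness for `b` near `s` with a copy of `(h, y)`, over `b ∘ e` and `h`. -/
theorem compatible_of_near {N n : ℕ} {b : Fin N → B} {s : Enumerated K N} {e : Fin n → Fin N}
    (hK : IsFraisse K) (hM : IsKStructure K M) {h y : Fin n → M}
    (hbh : SameType (fun i => b (e i)) h) {δ ε : ℝ} (hbs : Near K δ b s.tuple)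
    (hy : ∀ i, dist (h i) (y i) < ε) : Condition.Compatible s e y (δ + ε) := by
  obtain ⟨F, hF, b', s', hb, hs, hd⟩ := hbs
  obtain ⟨G, hG, g, hg⟩ := exists_sameType_mem hM (Sum.elim h y)
  obtain ⟨D, hD, f₁, f₂, hf⟩ := hK.exists_amalgam hF hG
    (((hb.reindex e).symm.trans hbh).trans (hg.reindex Sum.inl).symm)
  refine ⟨D, hD, _, _, hs.map f₁, (hg.reindex Sum.inr).symm.map f₂, fun i => ?_⟩
  calc dist (f₁ (s' (e i))) (f₂ (g (.inr i)))
      ≤ dist (f₁ (s' (e i))) (f₁ (b' (e i))) + dist (f₁ (b' (e i))) (f₂ (g (.inr i))) :=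
        dist_triangle _ _ _
    _ = dist (b' (e i)) (s' (e i)) + dist (h i) (y i) := by
        rw [f₁.dist_eq, hf, f₂.dist_eq, dist_comm, ← hg.dist_eq]
        rfl
    _ < δ + ε := add_lt_add (hd _) (hy i)

/-- Approximate the enumerated `B` by `s j ∈ S N`. Successive `s j` are close, so their copies in
`D` can be chosen to form a Cauchy sequence; by CP its limit has exactly the type of `B`. -/
theorem isApproximateLimit_of_dense (hK : IsFraisse K) (hM : IsSeparableKStructure K M)
    {D : Set M} (hD : Dense D) (S : ∀ N, Set (Enumerated K N))
    (hS : ∀ (N : ℕ) (A : MetricStructure.{u} L), K A → ∀ (a : Fin N → A) (ε : ℝ), 0 < ε →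
      ∃ s ∈ S N, Near K ε a s.tuple)
    (h : ∀ {N n : ℕ}, ∀ s ∈ S N, ∀ (e : Fin n → Fin N) (y : Fin n → M), (∀ i, y i ∈ D) →
      ∀ k : ℕ, Condition.Compatible s e y ((1 / 2 : ℝ) ^ k) →
        ∃ t : Fin N → M, (∀ i, t i ∈ D) ∧ SameType s.tuple t ∧
          ∀ i, dist (t (e i)) (y i) < (1 / 2 : ℝ) ^ k) :
    IsApproximateLimit K M := by
  refine ⟨hM, fun B _ hB n a x hax ε hε => ?_⟩
  have hB := mem_of_isKStructure hB
  obtain ⟨N, ⟨E⟩⟩ := Finite.exists_equiv_fin B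
  -- The total error is at most `2r` (limit to `t 0`), `r` (`t 0` to `y`) and `r / 4` (`y` to `x`),
  -- below `4r < ε`.
  obtain ⟨k, hk⟩ := exists_pow_lt_of_lt_one (show 0 < ε / 4 by positivity)
    (show (1 / 2 : ℝ) < 1 by norm_num)
  set r : ℝ := (1 / 2 : ℝ) ^ k with hr
  have hr₀ : 0 < r := by positivity
  choose s hsS hs using fun j : ℕ =>
    hS N B hB E.symm ((1 / 2 : ℝ) ^ (k + j + 2)) (by positivity)
  choose y hyD hy using fun i => hD.exists_dist_lt (x i) (show 0 < r / 4 by positivity)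
  have hpow : ∀ j i : ℕ, (1 / 2 : ℝ) ^ (k + j + i) = r * (1 / 2) ^ j * (1 / 2) ^ i := fun j i => by
    rw [pow_add, pow_add]
  obtain ⟨t₀, ht₀D, ht₀, hyt⟩ := h (s 0) (hsS 0) (fun i => E (a i)) y hyD k <| by
    obtain ⟨F, hF, s', y', h₁, h₂, h₃⟩ :=
      compatible_of_near (e := fun i => E (a i)) hK hM.2 
        (by simpa only [Equiv.symm_apply_apply] using (show SameType a x from hax)) (hs 0) hy
    refine ⟨F, hF, s', y', h₁, h₂, fun i => (h₃ i).trans_le ?_⟩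
    rw [hpow 0 2, ← hr]
    linarith
  obtain ⟨t, rfl, ht, htt⟩ := exists_seq_of_step
    (P := fun j (t : Fin N → M) => (∀ i, t i ∈ D) ∧ SameType (s j).tuple t)
    (Q := fun j t t' => ∀ i, dist (t' i) (t i) < (1 / 2 : ℝ) ^ (k + j)) ⟨ht₀D, ht₀⟩ <| by
    rintro j t ⟨htD, ht⟩
    -- For `e = id`, `Compatible` is `Near`; the errors `2⁻⁽ᵏ⁺ʲ⁺³⁾` and `2⁻⁽ᵏ⁺ʲ⁺²⁾` add up to less
    -- than `2⁻⁽ᵏ⁺ʲ⁾`.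
    obtain ⟨t', ht'D, ht', h'⟩ := h (s (j + 1)) (hsS _) id t htD (k + j) <| by
      refine (((hs (j + 1)).symm.trans hK (hs j)).congr_right ht).mono ?_
      have h₁ : k + (j + 1) + 2 = k + j + 3 := by ring
      have h₂ : (0 : ℝ) < r * (1 / 2) ^ j := by positivity
      rw [h₁, hpow, hpow, pow_add, ← hr]
      linarith
    exact ⟨t', ⟨ht'D, ht'⟩, h'⟩
  have hdist : ∀ i j, dist (t j i) (t (j + 1) i) ≤ 2 * r / 2 / 2 ^ j := fun i j => by
    rw [dist_comm]
    refine (htt j i).le.trans_eq ?_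
    rw [pow_add, one_div_pow _ j, ← hr]
    ring
  choose z hz using fun i => cauchySeq_tendsto_of_complete (cauchySeq_of_le_geometric_two (hdist i))
  have hzE : SameType E.symm z := by
    intro m P c
    refine tendsto_nhds_unique (((M.continuous_interp P).tendsto _).comp
      (tendsto_pi_nhds.2 fun i => hz (c i))) ?_
    refine (hK.cp.tendsto_interp hB E.symm (l := atTop) (fun j => (s j).tuple) ?_ P c).congr
      fun j => ((ht j).2 m P c).symm
    intro δ hδ
    obtain ⟨J, hJ⟩ := exists_pow_lt_of_lt_one hδ (show (1 / 2 : ℝ) < 1 by norm_num)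
    refine eventually_atTop.2 ⟨J, fun j hj => (hs j).mono (le_trans ?_ hJ.le)⟩
    exact pow_le_pow_of_le_one (by norm_num) (by norm_num) (by omega)
  have hzE' : SameType (fun x : B => x) (fun x => z (E x)) := by simpa using hzE.reindex E
  refine ⟨hzE'.toEmbedding, fun i => ?_⟩
  have h₁ := dist_le_of_le_geometric_two_of_tendsto₀ (hdist (E (a i))) (hz _)
  have h₂ := dist_triangle (z (E (a i))) (t 0 (E (a i))) (x i)
  have h₃ := dist_triangle (t 0 (E (a i))) (y i) (x i)
  rw [dist_comm] at h₁
  have h₄ := hy i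
  rw [dist_comm] at h₄
  have h₅ := hyt i
  change dist (z (E (a i))) (x i) < ε
  linarith

theorem isApproximateLimit_of_isEmpty (hK : IsFraisse K) (hA : K A)
    (hempty : ∀ B, K B → IsEmpty B) : IsApproximateLimit K A := by
  have := hempty A hA
  refine ⟨⟨inferInstance, hK.hp A hA⟩, fun B _ hB n a x hax ε hε => ?_⟩
  have hB := mem_of_isKStructure hB
  have := hempty B hB
  have : SameType (fun x : B => x) isEmptyElim := sameType_of_isEmpty (B := A) hK.jep hB hA _ _
  exact ⟨this.toEmbedding, fun i => isEmptyElim (a i)⟩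

theorem exists_isApproximateLimit (hK : IsFraisse K) (hne : ∃ A : MetricStructure.{u} L, K A) :
    ∃ M, IsApproximateLimit K M := by
  -- A condition carries a sequence in its ambient structure, so some member of `K` must be
  -- nonempty.
  by_cases hempty : ∀ B, K B → IsEmpty B
  · obtain ⟨A, hA⟩ := hne
    exact ⟨A, isApproximateLimit_of_isEmpty hK hA hempty⟩
  push Not at hempty
  obtain ⟨A, hA, ⟨a⟩⟩ := hempty
  choose S hSc hS using fun N => hK.pp.exists_countable N
  have := fun N => (hSc N).to_subtype
  let T := Σ N n : ℕ, S N × (Fin n → Fin N) × (Fin n → ℕ) × ℕ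
  let := Encodable.ofCountable T
  let 𝒟 : T → Order.Cofinal (Condition K) := fun i =>
    { carrier := {p | p.Meets i.2.2.1.1 i.2.2.2.1 i.2.2.2.2.1 ((1 / 2 : ℝ) ^ i.2.2.2.2.2)}
      isCofinal := Condition.exists_le_meets hK _ _ _ _ }
  let I := Order.idealOfCofinals ⟨0, A, hA, fun _ => a⟩ 𝒟
  have hI : ∀ {N n : ℕ}, ∀ s ∈ S N, ∀ (e : Fin n → Fin N) (y : Fin n → ℕ) (k : ℕ),
      ∃ p ∈ I, p.Meets s e y ((1 / 2 : ℝ) ^ k) := by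
    intro N n s hs e y k
    obtain ⟨p, hp, hpI⟩ := Order.cofinal_meets_idealOfCofinals
      ⟨0, A, hA, fun _ => a⟩ 𝒟 ⟨N, n, ⟨s, hs⟩, e, y, k⟩
    exact ⟨p, hpI, hp⟩
  -- Its only use is to make sizes unbounded: meeting a requirement with `y = n` forces `n <
  -- p.size`.
  obtain ⟨s₀, hs₀, -⟩ := hS 1 A hA (fun _ => a) 1 one_pos
  obtain ⟨M, hM, g, hg, hgI⟩ := exists_kStructure_of_ideal hK I fun n => by
    obtain ⟨p, hp, h, -⟩ := hI s₀ hs₀ (fun _ : Fin 1 => 0) (fun _ => n) 0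
    exact ⟨p, hp, h 0⟩
  refine ⟨M, isApproximateLimit_of_dense hK hM (D := Set.range g) hg S hS ?_⟩
  intro N n s hs e y hy k hcomp
  choose y' hy' using hy
  obtain rfl : (fun i => g (y' i)) = y := funext hy'
  obtain ⟨p, hp, hyp, hpc⟩ := hI s hs e y' k
  have hpg := hgI p hp
  obtain ⟨t, htp, ht, hte⟩ := hpc <| by
    obtain ⟨E, hE, s', z, h₁, h₂, h₃⟩ := hcomp
    exact ⟨E, hE, s', z, h₁, (hpg.reindex fun i => ⟨y' i, hyp i⟩).trans h₂, h₃⟩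
  refine ⟨fun i => g (t i), fun i => ⟨_, rfl⟩, ht.trans (hpg.reindex fun i => ⟨t i, htp i⟩),
    fun i => ?_⟩
  exact (hpg.dist_eq ⟨_, htp (e i)⟩ ⟨_, hyp i⟩).trans_lt (hte i)

/-! ### Approximate limits are exact -/

theorem finite_predSymbol {n : ℕ} (h : Finite (L n)) : Finite (PredSymbol L n) := by
  by_cases hn : n = 2
  · subst hn
    refine Finite.of_surjective (fun o : Option (L 2) => o.elim .metric .other) fun P => ?_
    cases P with
    | metric => exact ⟨none, rfl⟩
    | other R => exact ⟨some R, rfl⟩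
  · refine Finite.of_surjective (PredSymbol.other (L := L) (n := n)) fun P => ?_
    cases P with
    | metric => exact absurd rfl hn
    | other R => exact ⟨R, rfl⟩

/-- If the spaces of symbols are finite, then `d_∞` is continuous for `d_K` at each enumerated
structure. -/
theorem exists_distInfty_le (hL : ∀ n : ℕ, 1 ≤ n → Finite (L n)) (hCP : CP K) {n : ℕ}
    (x : Enumerated K n) {η : ℝ} (hη : 0 < η) :
    ∃ δ : ℝ, 0 < δ ∧ ∀ y : Enumerated K n, Near K δ x.tuple y.tuple →
      distInfty x y ≤ ENNReal.ofReal η := by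
  have h₁ : ∀ (m : ℕ) (P : PredSymbol L m) (s : Fin m ↪o Fin n), ∀ᶠ δ : ℝ in 𝓝[>] 0,
      ∀ y : Enumerated K n, Near K δ x.tuple y.tuple →
        |x.ambient.interp P (fun i => x.tuple (s i)) -
          y.ambient.interp P (fun i => y.tuple (s i))| < η := by
    intro m P s
    obtain ⟨δ, hδ, h⟩ := hCP.exists_near P x.mem (fun i => x.tuple (s i)) hη
    filter_upwards [Ioc_mem_nhdsGT hδ] with r hr y hy
    exact h _ _ ((hy.mono hr.2).reindex s)
  have h₂ : ∀ᶠ δ : ℝ in 𝓝[>] 0, ∀ m ∈ Finset.Icc 1 n, ∀ (P : PredSymbol L m)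
      (s : Fin m ↪o Fin n), ∀ y : Enumerated K n, Near K δ x.tuple y.tuple →
        |x.ambient.interp P (fun i => x.tuple (s i)) -
          y.ambient.interp P (fun i => y.tuple (s i))| < η := by
    refine (Finset.eventually_all _).2 fun m hm => ?_
    have := finite_predSymbol (hL m (Finset.mem_Icc.1 hm).1)
    exact eventually_all.2 fun P => eventually_all.2 fun s => h₁ m P s
  obtain ⟨δ, hδ, hδ₀⟩ := (h₂.and self_mem_nhdsWithin).exists
  refine ⟨δ, hδ₀, fun y hy => ?_⟩
  refine iSup_le fun m => iSup_le fun h => iSup_le fun h' => iSup_le fun P => iSup_le fun s => ?_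
  exact ENNReal.ofReal_le_ofReal (hδ m (Finset.mem_Icc.2 ⟨h, h'⟩) P s y hy).le

theorem dist_snoc_lt {α : Type*} [PseudoMetricSpace α] {n : ℕ} {a b : Fin n → α} {w z : α} {δ : ℝ}
    (h : ∀ i, dist (a i) (b i) < δ) (hwz : dist w z < δ) (i : Fin (n + 1)) :
    dist ((Fin.snoc a w : Fin (n + 1) → α) i) ((Fin.snoc b z : Fin (n + 1) → α) i) < δ := by
  cases i using Fin.lastCases with
  | last => simpa
  | cast i => simpa using h i

/-- One step in the construction of an exact extension: an element that together with a tuple close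
to `h` realizes the type of `x` can be moved by a small amount to one that does so together with a
tuple arbitrarily close to `h`. -/
theorem exists_step (hL : ∀ n : ℕ, 1 ≤ n → Finite (L n)) (hBAP : BAP K) (hCP : CP K)
    (hM : IsApproximateLimit K M) (hfin : ∀ A : MetricStructure.{u} L, K A → Finite A)
    (hHP : HP K) {n : ℕ} (hn : 1 ≤ n) (x : Enumerated K (n + 1)) {h : Fin n → M}
    (hxh : SameType (fun i : Fin n => x.tuple i.castSucc) h) {η : ℝ} (hη : 0 < η) :
    ∃ δ : ℝ, 0 < δ ∧ ∀ (a : Fin n → M) (z : M), SameType x.tuple (Fin.snoc a z : Fin (n + 1) → M) →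
      (∀ i, dist (a i) (h i) < δ) → ∀ ε : ℝ, 0 < ε → ∃ (a' : Fin n → M) (z' : M),
        SameType x.tuple (Fin.snoc a' z' : Fin (n + 1) → M) ∧ (∀ i, dist (a' i) (h i) < ε) ∧
        dist z z' ≤ η := by
  obtain ⟨c, hc⟩ := hBAP n hn
  -- One `η / 2` bounds `c * d_∞`, with `c + 1` in case `c = 0`; the other is for the approximate
  -- extension.
  have hη' : (0 : ℝ) < η / 2 / (c + 1) := by positivity
  obtain ⟨δ, hδ, hx⟩ := exists_distInfty_le hL hCP x hη'
  refine ⟨δ, hδ, fun a z haz ha ε hε => ?_⟩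
  obtain ⟨A, hA, b, hb⟩ := exists_sameType_mem hM.1.2 (Fin.snoc h z : Fin (n + 1) → M)
  have hnear : Near K δ x.tuple b :=
    ((Near.of_dist_lt hM.1.2 (dist_snoc_lt ha (by simpa using hδ))).congr_left
      haz.symm).congr_right hb.symm
  have hbh : SameType (fun i : Fin n => b i.castSucc) h := by
    simpa only [Fin.snoc_castSucc] using hb.reindex (Fin.castSucc : Fin n → Fin (n + 1))
  -- Over a common copy `a'` of `h`, the point `w'` realizes the type `x` and `z'` copies `z`.
  -- Mapping `(a', z')` approximately to `(h, z)` carries `w'` near `z`.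
  obtain ⟨C, hC, a', w', z', hxw, hbz, hwz⟩ := hc x ⟨A, hA, b⟩ (hxh.trans hbh.symm)
  have hwz' : dist w' z' ≤ η / 2 := by
    have h₁ : (c : ℝ≥0∞) * distInfty x ⟨A, hA, b⟩ ≤ ENNReal.ofReal (η / 2) := by
      refine (mul_le_mul_right (hx ⟨A, hA, b⟩ hnear) _).trans ?_
      rw [← ENNReal.ofReal_coe_nnreal, ← ENNReal.ofReal_mul c.coe_nonneg]
      refine ENNReal.ofReal_le_ofReal ?_
      rw [mul_div_assoc', div_le_iff₀ (by positivity)]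
      nlinarith [c.2]
    exact (edist_le_ofReal (by positivity)).1 (hwz.trans h₁)
  have hCz : SameType (Fin.snoc a' z' : Fin (n + 1) → C) (Fin.snoc h z : Fin (n + 1) → M) :=
    (SameType.symm hbz).trans hb
  obtain ⟨f, hf⟩ := hM.2 C (hfin C hC) (hHP C hC) (n + 1) _ _ hCz (min ε (η / 2))
    (lt_min hε (half_pos hη))
  refine ⟨fun i => f (a' i), f w', ?_, fun i => ?_, ?_⟩
  · convert SameType.map hxw f using 1
    funext i
    cases i using Fin.lastCases <;> simp
  · have := hf i.castSucc
    simp only [Fin.snoc_castSucc] at this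
    exact this.trans_le (min_le_left _ _)
  · have h₁ := hf (Fin.last n)
    simp only [Fin.snoc_last] at h₁
    have h₂ := h₁.trans_le (min_le_right _ _)
    have h₃ := dist_triangle (f w') (f z') z
    rw [f.dist_eq] at h₃
    rw [dist_comm]
    linarith

/-- Iterate `exists_step`: the tuples tend to `h`, the last entries form a Cauchy sequence, and
continuity of the predicates preserves the type in the limit. -/
theorem exists_snoc_extension (hL : ∀ n : ℕ, 1 ≤ n → Finite (L n)) (hBAP : BAP K) (hCP : CP K)
    (hM : IsApproximateLimit K M) (hfin : ∀ A : MetricStructure.{u} L, K A → Finite A)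
    (hHP : HP K) {n : ℕ} (hn : 1 ≤ n) (x : Enumerated K (n + 1)) {h : Fin n → M}
    (hxh : SameType (fun i : Fin n => x.tuple i.castSucc) h) :
    ∃ z : M, SameType x.tuple (Fin.snoc h z : Fin (n + 1) → M) := by
  choose δ hδ hstep using fun j : ℕ =>
    exists_step hL hBAP hCP hM hfin hHP hn x hxh (show 0 < (1 / 2 : ℝ) ^ j by positivity)
  -- `δ j` lets step `j` start; `1 / (j + 1)` makes the tuples converge to `h`.
  let r : ℕ → ℝ := fun j => min (δ j) (1 / ((j : ℝ) + 1))
  have hr : ∀ j, 0 < r j := fun j => lt_min (hδ j) (by positivity)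
  obtain ⟨f, hf⟩ := hM.2 x.ambient (hfin _ x.mem) (hHP _ x.mem) n
    (fun i => x.tuple i.castSucc) h hxh (r 0) (hr 0)
  obtain ⟨g, -, hg, hgd⟩ := exists_seq_of_step (α := (Fin n → M) × M)
    (P := fun j p => SameType x.tuple (Fin.snoc p.1 p.2 : Fin (n + 1) → M) ∧
      ∀ i, dist (p.1 i) (h i) < r j)
    (Q := fun j p q => dist p.2 q.2 ≤ (1 / 2 : ℝ) ^ j)
    (a₀ := (fun i => f (x.tuple i.castSucc), f (x.tuple (Fin.last n))))
    ⟨by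
      convert f.sameType x.tuple using 1
      funext i
      cases i using Fin.lastCases <;> simp, hf⟩ <| by
    rintro j ⟨a, z⟩ ⟨h₁, h₂⟩
    obtain ⟨a', z', h₃, h₄, h₅⟩ := hstep j a z h₁ (fun i => (h₂ i).trans_le (min_le_left _ _))
      (r (j + 1)) (hr _)
    exact ⟨(a', z'), ⟨h₃, h₄⟩, h₅⟩
  have hgd' : ∀ j, dist (g j).2 (g (j + 1)).2 ≤ 2 / 2 / 2 ^ j := fun j => by
    refine (hgd j).trans_eq ?_
    rw [one_div_pow]
    ring
  obtain ⟨z, hz⟩ := cauchySeq_tendsto_of_complete (cauchySeq_of_le_geometric_two hgd')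
  refine ⟨z, fun m P s => ?_⟩
  have hlim : Tendsto (fun j => (Fin.snoc (g j).1 (g j).2 : Fin (n + 1) → M)) atTop
      (𝓝 (Fin.snoc h z : Fin (n + 1) → M)) := by
    refine tendsto_pi_nhds.2 fun i => ?_
    cases i using Fin.lastCases with
    | last => simpa using hz
    | cast i =>
      simp only [Fin.snoc_castSucc]
      refine tendsto_iff_dist_tendsto_zero.2 (squeeze_zero (fun _ => dist_nonneg)
        (fun j => ?_) tendsto_one_div_add_atTop_nhds_zero_nat)
      exact ((hg j).2 i).le.trans (min_le_right _ _)
  have h₁ := (((M.continuous_interp P).tendsto _).comp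
    (tendsto_pi_nhds.2 fun i => (tendsto_pi_nhds.1 hlim) (s i)))
  exact tendsto_nhds_unique h₁ (tendsto_const_nhds.congr fun j => ((hg j).1 m P s).symm)

/-- Extend `h` by the points of `B` one at a time. Over the empty tuple, where bAP says nothing,
approximate extension is already exact. -/
theorem IsApproximateLimit.isExactLimit (hM : IsApproximateLimit K M)
    (hL : ∀ n : ℕ, 1 ≤ n → Finite (L n)) (hBAP : BAP K) (hCP : CP K)
    (hfin : ∀ A : MetricStructure.{u} L, K A → Finite A) (hHP : HP K) : IsExactLimit K M := by
  refine ⟨hM.1, fun B hBfin hB' n a h hah => ?_⟩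
  have hB := mem_of_isKStructure hB'
  rcases n with _ | n
  · obtain ⟨f, -⟩ := hM.2 B hBfin hB' 0 a h hah 1 one_pos
    exact ⟨f, fun i => i.elim0⟩
  have main : ∀ (k : ℕ) (d : Fin k → B), ∃ g : Fin k → M,
      SameType (Sum.elim a d) (Sum.elim h g) := by
    intro k
    induction k with
    | zero =>
      intro d
      refine ⟨Fin.elim0, SameType.of_surjective (e := Sum.inl) ?_ (show SameType a h from hah)⟩
      rintro (i | i)
      exacts [⟨i, rfl⟩, i.elim0]
    | succ k ih =>
      intro d
      obtain ⟨g, hg⟩ := ih fun i => d i.castSucc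
      obtain ⟨E⟩ : Nonempty (Fin (n + 1) ⊕ Fin k ≃ Fin (n + 1 + k)) := ⟨finSumFinEquiv⟩
      obtain ⟨z, hz⟩ := exists_snoc_extension hL hBAP hCP hM hfin hHP (by omega)
        ⟨B, hB, Fin.snoc (fun i => Sum.elim a (fun i => d i.castSucc) (E.symm i)) (d (Fin.last k))⟩
        (h := fun i => Sum.elim h g (E.symm i))
        (by simpa only [Fin.snoc_castSucc] using hg.reindex E.symm)
      refine ⟨Fin.snoc g z, ?_⟩
      convert hz.reindex (Sum.elim (fun i => (E (.inl i)).castSucc)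
        (Fin.snoc (fun i => (E (.inr i)).castSucc) (Fin.last _)) :
          Fin (n + 1) ⊕ Fin (k + 1) → Fin (n + 1 + k + 1)) using 1
      all_goals
        funext i
        rcases i with i | i
        · simp
        · cases i using Fin.lastCases <;> simp
  obtain ⟨k, ⟨e⟩⟩ := Finite.exists_equiv_fin B
  obtain ⟨g, hg⟩ := main k e.symm
  have hg' : SameType (fun x : B => x) (fun x => g (e x)) := by
    simpa using hg.reindex fun x : B => Sum.inr (e x)
  refine ⟨hg'.toEmbedding, fun i => ?_⟩
  exact (hg.eq_iff (.inr (e (a i))) (.inl i)).2 (by simp)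

/-! ### Back-and-forth -/

/-- A relation between two structures is a partial isomorphism if it preserves the values of all
predicate symbols. -/
def IsPartialIso (r : Set (N × M)) : Prop :=
  SameType (fun p : r => p.1.1) (fun p : r => p.1.2)

namespace IsPartialIso

variable {r : Set (N × M)}

theorem interp_eq (hr : IsPartialIso r) {m : ℕ} (P : PredSymbol L m) {p : Fin m → N × M}
    (hp : ∀ i, p i ∈ r) : M.interp P (fun i => (p i).2) = N.interp P (fun i => (p i).1) :=
  hr m P fun i => ⟨p i, hp i⟩

theorem dist_eq (hr : IsPartialIso r) {p q : N × M} (hp : p ∈ r) (hq : q ∈ r) :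
    dist p.1 q.1 = dist p.2 q.2 :=
  (SameType.dist_eq hr ⟨p, hp⟩ ⟨q, hq⟩).symm

theorem eq_iff (hr : IsPartialIso r) {p q : N × M} (hp : p ∈ r) (hq : q ∈ r) :
    p.2 = q.2 ↔ p.1 = q.1 :=
  SameType.eq_iff hr ⟨p, hp⟩ ⟨q, hq⟩

theorem swap (hr : IsPartialIso r) : IsPartialIso (Prod.swap ⁻¹' r) :=
  (SameType.symm hr).reindex fun p : Prod.swap ⁻¹' r => (⟨p.1.swap, p.2⟩ : r)

theorem range {ι : Type*} {a : ι → N} {b : ι → M} (h : SameType a b) :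
    IsPartialIso (Set.range fun i => (a i, b i)) := by
  refine SameType.of_surjective (e := fun i => (⟨(a i, b i), i, rfl⟩ :
    Set.range fun i => (a i, b i))) ?_ h
  rintro ⟨-, i, rfl⟩
  exact ⟨i, rfl⟩

theorem insert {x : N} {y : M}
    (h : SameType (adjoin (fun p : r => p.1.1) x) (adjoin (fun p : r => p.1.2) y)) :
    IsPartialIso (insert (x, y) r) := by
  classical
  let e : ↥(Insert.insert (x, y) r) → Option r := fun q =>
    if hq : q.1 ∈ r then some ⟨q.1, hq⟩ else none
  have he : ∀ q : ↥(Insert.insert (x, y) r), adjoin (fun p : r => p.1.1) x (e q) = q.1.1 ∧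
      adjoin (fun p : r => p.1.2) y (e q) = q.1.2 := by
    rintro ⟨q, hq⟩
    by_cases hqr : q ∈ r
    · simp [e, hqr]
    · obtain rfl := hq.resolve_right hqr
      simp [e, hqr]
  have := h.reindex e
  simp only [fun q => (he q).1, fun q => (he q).2] at this
  exact this

/-- Equality of continuous values is a closed condition on tuples of pairs, and the closure of a
power is the power of the closure. -/
theorem closure (hr : IsPartialIso r) : IsPartialIso (closure r) := by
  intro m P s
  have hclosed : IsClosed {p : Fin m → N × M |
      M.interp P (fun i => (p i).2) = N.interp P (fun i => (p i).1)} :=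
    isClosed_eq ((M.continuous_interp P).comp (by fun_prop))
      ((N.continuous_interp P).comp (by fun_prop))
  have hsub : Set.univ.pi (fun _ : Fin m => r) ⊆ {p : Fin m → N × M |
      M.interp P (fun i => (p i).2) = N.interp P (fun i => (p i).1)} :=
    fun p hp => hr.interp_eq P fun i => hp i trivial
  have := closure_minimal hsub hclosed
  rw [closure_pi_set] at this
  exact this fun i _ => (s i).2

end IsPartialIso

theorem exists_mem_closure_of_dense {α β : Type*} [PseudoMetricSpace α] [PseudoMetricSpace β]
    [CompleteSpace β] {r : Set (α × β)} (hr : ∀ p ∈ r, ∀ q ∈ r, dist p.1 q.1 = dist p.2 q.2)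
    (hd : Dense (Prod.fst '' r)) (x : α) : ∃ y, (x, y) ∈ closure r := by
  obtain ⟨a, ha, hax⟩ := mem_closure_iff_seq_limit.1 (hd x)
  choose p hp hpa using ha
  obtain rfl : (fun k => (p k).1) = a := funext hpa
  have hcauchy : CauchySeq fun k => (p k).2 := by
    have := hax.cauchySeq
    rw [Metric.cauchySeq_iff] at this ⊢
    simpa only [hr _ (hp _) _ (hp _)] using this
  obtain ⟨y, hy⟩ := cauchySeq_tendsto_of_complete hcauchy
  exact ⟨y, mem_closure_of_tendsto (hax.prodMk_nhds hy) (Eventually.of_forall hp)⟩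

/-- Finite partial isomorphisms, ordered by extension. -/
abbrev FinitePartialIso (N M : MetricStructure.{u} L) : Type u :=
  {r : Set (N × M) // r.Finite ∧ IsPartialIso r}

/-- Take the union of a generic ideal; by directedness finitely many of its pairs lie in a single
finite partial isomorphism. -/
theorem exists_isPartialIso_of_cofinal {T : Type*} [Countable T]
    (𝒟 : T → Order.Cofinal (FinitePartialIso N M)) (r₀ : FinitePartialIso N M) :
    ∃ R : Set (N × M), IsPartialIso R ∧ r₀.1 ⊆ R ∧ ∀ t, ∃ r ∈ 𝒟 t, r.1 ⊆ R := by
  let := Encodable.ofCountable T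
  let I := Order.idealOfCofinals r₀ 𝒟
  refine ⟨⋃ r ∈ I, r.1, ?_, ?_, fun t => ?_⟩
  · intro m P s
    have h : ∀ i, ∃ r ∈ I, (s i).1 ∈ r.1 := fun i => by
      obtain ⟨r, hr, h⟩ := Set.mem_iUnion₂.1 (s i).2
      exact ⟨r, hr, h⟩
    choose q hqI hq using h
    have hdir : Directed (· ≤ ·) (Subtype.val : I → FinitePartialIso N M) :=
      directedOn_iff_directed.1 I.directed
    have : Nonempty I := ⟨⟨r₀, Order.mem_idealOfCofinals _ _⟩⟩
    obtain ⟨r, hr⟩ := hdir.finite_le fun i => (⟨q i, hqI i⟩ : I)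
    exact r.1.2.2.interp_eq P fun i => hr i (hq i)
  · exact Set.subset_biUnion_of_mem (u := fun r : FinitePartialIso N M => r.1)
      (Order.mem_idealOfCofinals r₀ 𝒟)
  · obtain ⟨r, hr, hrI⟩ := Order.cofinal_meets_idealOfCofinals r₀ 𝒟 t
    exact ⟨r, hr, Set.subset_biUnion_of_mem (u := fun r : FinitePartialIso N M => r.1) hrI⟩

/-- Finite partial isomorphisms from `N` to `M` extend to one further element of `N`. -/
def ExtensionProperty (N M : MetricStructure.{u} L) : Prop :=
  ∀ r : Set (N × M), r.Finite → IsPartialIso r → ∀ x, ∃ y, IsPartialIso (insert (x, y) r)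

theorem ExtensionProperty.exists_insert_swap (h : ExtensionProperty M N) {r : Set (N × M)}
    (hfin : r.Finite) (hr : IsPartialIso r) (y : M) : ∃ x, IsPartialIso (insert (x, y) r) := by
  obtain ⟨x, hx⟩ := h (Prod.swap ⁻¹' r) (hfin.preimage Prod.swap_injective.injOn) hr.swap y
  refine ⟨x, ?_⟩
  convert hx.swap using 1
  ext ⟨a, b⟩
  simp [and_comm]

/-- The finite partial isomorphisms whose domain contains `x`. -/
def ExtensionProperty.domCofinal (h : ExtensionProperty N M) (x : N) :
    Order.Cofinal (FinitePartialIso N M) where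
  carrier := {r | ∃ y, (x, y) ∈ r.1}
  isCofinal r := by
    obtain ⟨y, hy⟩ := h r.1 r.2.1 r.2.2 x
    exact ⟨⟨_, r.2.1.insert _, hy⟩, ⟨y, Set.mem_insert _ _⟩, Set.subset_insert _ _⟩

/-- The finite partial isomorphisms whose range contains `y`. -/
def ExtensionProperty.rangeCofinal (h : ExtensionProperty M N) (y : M) :
    Order.Cofinal (FinitePartialIso N M) where
  carrier := {r | ∃ x, (x, y) ∈ r.1}
  isCofinal r := by
    obtain ⟨x, hx⟩ := h.exists_insert_swap r.2.1 r.2.2 y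
    exact ⟨⟨_, r.2.1.insert _, hx⟩, ⟨x, Set.mem_insert _ _⟩, Set.subset_insert _ _⟩

theorem exists_embedding_of_dense {R : Set (N × M)} (hR : IsPartialIso R)
    (hd : Dense (Prod.fst '' R)) :
    ∃ f : Embedding N M, ∀ p ∈ closure R, f p.1 = p.2 := by
  choose f hf using exists_mem_closure_of_dense (fun p hp q hq => hR.dist_eq hp hq) hd
  have h : SameType (fun x : N => x) f :=
    SameType.reindex hR.closure fun x : N => (⟨(x, f x), hf x⟩ : closure R)
  exact ⟨h.toEmbedding, fun p hp => (hR.closure.eq_iff (hf p.1) hp).2 rfl⟩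

theorem ExtensionProperty.exists_embedding (h : ExtensionProperty N M)
    (hN : TopologicalSpace.SeparableSpace N) {r : Set (N × M)} (hfin : r.Finite)
    (hr : IsPartialIso r) : ∃ f : Embedding N M, ∀ p ∈ r, f p.1 = p.2 := by
  obtain ⟨S, hS, hSd⟩ := TopologicalSpace.exists_countable_dense N
  have := hS.to_subtype
  obtain ⟨R, hR, hrR, hSR⟩ := exists_isPartialIso_of_cofinal
    (fun x : S => h.domCofinal x.1) ⟨r, hfin, hr⟩
  obtain ⟨f, hf⟩ := exists_embedding_of_dense hR <| hSd.mono fun x hx => by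
    obtain ⟨r', ⟨y, hy⟩, hr'⟩ := hSR ⟨x, hx⟩
    exact ⟨(x, y), hr' hy, rfl⟩
  exact ⟨f, fun p hp => hf p (subset_closure (hrR hp))⟩

/-- The generic relation has dense domain and dense range; by completeness its closure is the graph
of a bijection. -/
theorem ExtensionProperty.exists_surjective_embedding (h : ExtensionProperty N M)
    (h' : ExtensionProperty M N) (hN : TopologicalSpace.SeparableSpace N)
    (hM : TopologicalSpace.SeparableSpace M) {r : Set (N × M)} (hfin : r.Finite)
    (hr : IsPartialIso r) :
    ∃ f : Embedding N M, Function.Surjective f ∧ ∀ p ∈ r, f p.1 = p.2 := by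
  obtain ⟨S, hS, hSd⟩ := TopologicalSpace.exists_countable_dense N
  obtain ⟨T, hT, hTd⟩ := TopologicalSpace.exists_countable_dense M
  have := hS.to_subtype
  have := hT.to_subtype
  obtain ⟨R, hR, hrR, hSR⟩ := exists_isPartialIso_of_cofinal
    (Sum.elim (fun x : S => h.domCofinal x.1) (fun y : T => h'.rangeCofinal y.1)) ⟨r, hfin, hr⟩
  obtain ⟨f, hf⟩ := exists_embedding_of_dense hR <| hSd.mono fun x hx => by
    obtain ⟨r', ⟨y, hy⟩, hr'⟩ := hSR (.inl ⟨x, hx⟩)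
    exact ⟨(x, y), hr' hy, rfl⟩
  refine ⟨f, fun y => ?_, fun p hp => hf p (subset_closure (hrR hp))⟩
  obtain ⟨x, hx⟩ := exists_mem_closure_of_dense
    (fun p hp q hq => hR.swap.dist_eq hp hq) (hTd.mono fun y hy => by
      obtain ⟨r', ⟨x, hx⟩, hr'⟩ := hSR (.inr ⟨y, hy⟩)
      exact ⟨(y, x), hr' hx, rfl⟩) y
  refine ⟨x, hf (x, y) ?_⟩
  have := (Homeomorph.prodComm M N).preimage_closure R
  exact (Set.ext_iff.1 this (y, x)).2 hx

/-- Realize the domain of `r` together with `x` in `K`, then extend the map to the range of `r`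
exactly. -/
theorem IsExactLimit.extensionProperty (hM : IsExactLimit K M) (hN : IsKStructure K N)
    (hfin : ∀ A : MetricStructure.{u} L, K A → Finite A) (hHP : HP K) :
    ExtensionProperty N M := by
  intro r hr_fin hr x
  have := hr_fin.to_subtype
  obtain ⟨n, ⟨e⟩⟩ := Finite.exists_equiv_fin r
  obtain ⟨A, hA, a, ha⟩ := exists_sameType_mem hN (adjoin (fun p : r => p.1.1) x)
  have h₁ : SameType (fun p : r => a (some p)) (fun p => p.1.2) :=
    (ha.reindex (some : r → Option r)).trans hr
  obtain ⟨f, hf⟩ := hM.2 A (hfin A hA) (hHP A hA) n (fun i => a (some (e.symm i)))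
    (fun i => (e.symm i).1.2) (h₁.reindex e.symm)
  refine ⟨f (a none), IsPartialIso.insert ?_⟩
  have h₂ : (fun o => f (a o)) = adjoin (fun p : r => p.1.2) (f (a none)) := by
    funext o
    rcases o with _ | p
    · rfl
    · simpa using hf (e p)
  rw [← h₂]
  exact ha.symm.trans (f.sameType a)

theorem IsExactLimit.ultrahomogeneous (hM : IsExactLimit K M)
    (hfin : ∀ A : MetricStructure.{u} L, K A → Finite A) (hHP : HP K) : Ultrahomogeneous M := by
  intro S hS φ hφ
  have := hS.to_subtype
  have hext := hM.extensionProperty hM.1.2 hfin hHP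
  have hsame : SameType (fun x : S => (x : M)) φ := hφ
  obtain ⟨f, hf, hfφ⟩ := hext.exists_surjective_embedding hext hM.1.1 hM.1.1
    (Set.finite_range _) (IsPartialIso.range hsame)
  exact ⟨f, hf, fun x => hfφ _ ⟨x, rfl⟩⟩

/-- The start of back-and-forth has content: `0`-ary symbols must agree, which is due to JEP. -/
theorem isPartialIso_empty (hJEP : JEP K) (hN : IsKStructure K N) (hM : IsKStructure K M) :
    IsPartialIso (∅ : Set (N × M)) := by
  obtain ⟨A, hA, a, ha⟩ := exists_sameType_mem hN fun p : (∅ : Set (N × M)) => p.1.1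
  obtain ⟨B, hB, b, hb⟩ := exists_sameType_mem hM fun p : (∅ : Set (N × M)) => p.1.2
  exact (ha.symm.trans (sameType_of_isEmpty hJEP hA hB a b)).trans hb

theorem IsExactLimit.isUniversal (hM : IsExactLimit K M)
    (hfin : ∀ A : MetricStructure.{u} L, K A → Finite A) (hHP : HP K) (hJEP : JEP K) :
    IsUniversal K M := by
  intro N hN
  obtain ⟨f, -⟩ := (hM.extensionProperty hN.2 hfin hHP).exists_embedding hN.1 Set.finite_empty
    (isPartialIso_empty hJEP hN.2 hM.1.2)
  exact ⟨f⟩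

theorem IsExactLimit.isomorphic (hM : IsExactLimit K M) (hN : IsExactLimit K N)
    (hfin : ∀ A : MetricStructure.{u} L, K A → Finite A) (hHP : HP K) (hJEP : JEP K) :
    Isomorphic M N := by
  obtain ⟨f, hf, -⟩ := (hN.extensionProperty hM.1.2 hfin hHP).exists_surjective_embedding
    (hM.extensionProperty hN.1.2 hfin hHP) hM.1.1 hN.1.1 Set.finite_empty
    (isPartialIso_empty hJEP hM.1.2 hN.1.2)
  exact ⟨f, hf⟩

/-- Embed `B` by universality, then correct by an automorphism carrying the image of `a` to `h`. -/
theorem isExactLimit_of_ultrahomogeneous (hN : IsSeparableKStructure K N)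
    (hultra : Ultrahomogeneous N) (huniv : IsUniversal K N) : IsExactLimit K N := by
  refine ⟨hN, fun B hBfin hB n a h hah => ?_⟩
  obtain ⟨g⟩ := huniv B ⟨(Set.toFinite (Set.univ : Set B)).countable |>
    fun hc => ⟨⟨Set.univ, hc, dense_univ⟩⟩, hB⟩
  have hgh : SameType (fun i => g (a i)) h := (g.sameType a).symm.trans hah
  let S := Set.range fun i => g (a i)
  choose r hr using fun x : S => x.2
  obtain ⟨f, -, hf⟩ := hultra S (Set.finite_range _) (fun x => h (r x)) <| by
    intro m P x
    have := hgh m P fun i => r (x i)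
    simpa only [hr] using this
  refine ⟨f.comp g, fun i => (hf ⟨g (a i), i, rfl⟩).trans ?_⟩
  exact (hgh.eq_iff _ _).2 (hr ⟨g (a i), i, rfl⟩)

/-! ### Uniform continuity -/

theorem IsApproximateLimit.nonempty_embedding (hM : IsApproximateLimit K M)
    (hfin : ∀ A : MetricStructure.{u} L, K A → Finite A) (hHP : HP K) (hJEP : JEP K) (hA : K A) :
    Nonempty (Embedding A M) := by
  obtain ⟨B, hB, b, hb⟩ := exists_sameType_mem hM.1.2 (Fin.elim0 : Fin 0 → M)
  obtain ⟨f, -⟩ := hM.2 A (hfin A hA) (hHP A hA) 0 Fin.elim0 Fin.elim0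
    ((sameType_of_isEmpty hJEP hA hB _ b).trans hb) 1 one_pos
  exact ⟨f⟩

theorem uniformContinuous_interp (hM : UniformlyContinuous M) {n : ℕ} (P : PredSymbol L n) :
    UniformContinuous (M.interp P) := by
  cases P with
  | metric =>
    exact (Pi.uniformContinuous_proj (fun _ : Fin 2 => M) 0).dist (Pi.uniformContinuous_proj _ 1)
  | other R => exact hM n R

/-- Witnesses of `d_K`-closeness embed in `M`, and close tuples of `M` have `d_K`-close types; so
moduli of continuity transfer both ways. -/
theorem IsApproximateLimit.uniformlyContinuous_iff (hM : IsApproximateLimit K M)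
    (hfin : ∀ A : MetricStructure.{u} L, K A → Finite A) (hHP : HP K) (hJEP : JEP K) :
    UniformlyContinuous M ↔ UniformCP K := by
  constructor
  · intro h n P ε hε
    obtain ⟨δ, hδ, hP⟩ := Metric.uniformContinuous_iff.1 (uniformContinuous_interp h P) ε hε
    refine ⟨ENNReal.ofReal δ, ENNReal.ofReal_pos.2 hδ, fun a b hab => ?_⟩
    obtain ⟨C, hC, a', b', ha, hb, hd⟩ := (near_iff_distK_lt hδ).2 hab
    obtain ⟨f⟩ := hM.nonempty_embedding hfin hHP hJEP hC
    have h₁ : M.interp P (fun i => f (a' i)) = a.value P := (ha.map f) n P id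
    have h₂ : M.interp P (fun i => f (b' i)) = b.value P := (hb.map f) n P id
    rw [← h₁, ← h₂, ← Real.dist_eq]
    exact hP ((dist_pi_lt_iff hδ).2 fun i => (f.dist_eq _ _).trans_lt (hd i))
  · intro h n R
    refine Metric.uniformContinuous_iff.2 fun ε hε => ?_
    obtain ⟨δ, hδ, hR⟩ := h n (.other R) ε hε
    obtain ⟨r, hr, hr'⟩ := exists_ofReal_le hδ
    refine ⟨r, hr, fun x y hxy => ?_⟩
    obtain ⟨A, hA, a, ha⟩ := exists_sameType_mem hM.1.2 x
    obtain ⟨B, hB, b, hb⟩ := exists_sameType_mem hM.1.2 y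
    have hnear : Near K r a b := ((Near.of_dist_lt hM.1.2 fun i =>
      (dist_pi_lt_iff hr).1 hxy i).congr_left ha.symm).congr_right hb.symm
    have := hR ⟨A, hA, a⟩ ⟨B, hB, b⟩ (((near_iff_distK_lt hr).1 hnear).trans_le hr')
    have h₁ : M.rel R x = A.rel R a := ha n (.other R) id
    have h₂ : M.rel R y = B.rel R b := hb n (.other R) id
    rw [Real.dist_eq, h₁, h₂]
    exact this

end FraisseClass

open MetricStructure FraisseClass in
theorem mainTheorem1 {L : ℕ → Type v} (hL : ∀ n : ℕ, 1 ≤ n → Finite (L n))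
    (K : MetricStructure.{u} L → Prop) (hne : ∃ A : MetricStructure.{u} L, K A)
    (hfin : ∀ A : MetricStructure.{u} L, K A → Finite A)
    (hHP : HP K) (hJEP : JEP K) (hBAP : BAP K) (hPP : PP K) (hCP : CP K) :
    IsFraisse K ∧
    (∃ M : MetricStructure.{u} L, IsApproximateLimit K M) ∧
    ∀ M : MetricStructure.{u} L, IsApproximateLimit K M →
      IsExactLimit K M ∧
      Ultrahomogeneous M ∧
      IsUniversal K M ∧
      (∀ N : MetricStructure.{u} L, IsApproximateLimit K N → Isomorphic M N) ∧
      (∀ N : MetricStructure.{u} L, IsSeparableKStructure K N → Ultrahomogeneous N →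
        IsUniversal K N → Isomorphic M N) ∧
      (UniformlyContinuous M ↔ UniformCP K) := by
  have hK : IsFraisse K := ⟨hfin, hHP, hJEP, ap_of_bap hBAP hJEP hfin, hPP, hCP⟩
  have hexact : ∀ M, IsApproximateLimit K M → IsExactLimit K M := fun M hM =>
    hM.isExactLimit hL hBAP hCP hfin hHP
  refine ⟨hK, exists_isApproximateLimit hK hne, fun M hM => ?_⟩
  have hM' := hexact M hM
  exact ⟨hM', hM'.ultrahomogeneous hfin hHP, hM'.isUniversal hfin hHP hJEP,
    fun N hN => hM'.isomorphic (hexact N hN) hfin hHP hJEP,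
    fun N hN hultra huniv =>
      hM'.isomorphic (isExactLimit_of_ultrahomogeneous hN hultra huniv) hfin hHP hJEP,
    hM.uniformlyContinuous_iff hfin hHP hJEP⟩
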